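/- Let $q\ge 5$ be a prime power. Define $$(\mathcal N_1,\mathcal N_2,\mathcal N_3)=\left(\tfrac{q^2+q}{2},\tfrac{q^2-q}{2},1\right),\quad (\mathbb B_1,\mathbb B_2,\mathbb B_3)=\left(\tfrac{q-1}{2},\tfrac{q-3}{2},0\right)\quad\text{if } q \text{ is odd},$$ $$(\mathcal N_1,\mathcal N_2,\mathcal N_3)=(q-1,\,q^2-q,\,2),\quad (\mathbb B_1,\mathbb B_2,\mathbb B_3)=\left(\tfrac{q}{2},\tfrac{q-2}{2},0\right)\quad\text{if } q \text{ is even}.$$ (1) Let $\mathcal K\subset\mathrm{PG}(2,q)$ be a conic, that is, a point set projectively equivalent to $\{(1,t,t^2):t\in\mathbb F_q\}\cup\{(0,0,1)\}$, let $P\in\mathcal K$, and let $\mathcal K^*=\mathcal K\setminus\{P\}$. A bisecant of $\mathcal K^*$ is a line having exactly two points in common with $\mathcal K^*$. Then there are $q^2+1$ points off $\mathcal K^*$, and they can be partitioned into three classes $\mathcal A_1,\mathcal A_2,\mathcal A_3$ such that $\#\mathcal A_j=\mathcal N_j$ and every point of $\mathcal A_j$ lies on exactly $\mathbb B_j$ bisecants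 of $\mathcal K^*$, $j=1,2,3$. (2) Let $\alpha_1,\dots,\alpha_q$ be all the elements of $\mathbb F_q$ in some order, let $v_1,\dots,v_{q+1}\in\mathbb F_q^*$, and let $H$ be obtained by removing any one column from the $3\times(q+1)$ matrix with columns $v_i(1,\alpha_i,\alpha_i^2)^{tr}$, $1\le i\le q$, and $v_{q+1}(0,0,1)^{tr}$. Let $\mathcal C=\{\mathbf c\in\mathbb F_q^q: H\mathbf c^{tr}=0\}$. Let $A_w(\mathcal C)$ be the number of codewords of Hamming weight $w$ in $\mathcal C$, and, for a coset $\mathcal V$ of $\mathcal C$ in $\mathbb F_q^q$, let $B_w(\mathcal V)$ be the number of vectors of weight $w$ in $\mathcal V$; the weight of a coset is the smallest weight of a vector in it. Then $\mathcal C$ has dimension $q-3$, minimum distance $4$ and covering radius $R=3$. The columns of $H$ represent, each exactly once, the points of the shortened conic $\mathcal K\setminus\{P\}$, where $\mathcal K=\{(1,t,t^2):t\in\mathbb F_q\}\cup\{(0,0,1)\}$ and $P\in\mathcal K$ is the point of the removed column. Moreover: (a) There are exactly $(q-1)\mathcal N_1$ cosets $\mathcal V$ of weight $2$ with $B_2(\mathcal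 V)=\mathbb B_1$ and exactly $(q-1)\mathcal N_2$ cosets $\mathcal V$ of weight $2$ with $B_2(\mathcal V)=\mathbb B_2$, and every coset of weight $2$ is of one of these two kinds. Every coset $\mathcal V$ of weight $2$ satisfies $B_0(\mathcal V)=B_1(\mathcal V)=0$ and $$B_w(\mathcal V)=A_w(\mathcal C)-(-1)^w\binom{q}{w}\binom{w-1}{2}+(-1)^w\binom{q-2}{q-w}B_2(\mathcal V),\qquad w=3,4,\dots,q.$$ (b) There are exactly $(q-1)\mathcal N_3$ cosets of weight $3$, and each such coset $\mathcal V$ satisfies $B_0(\mathcal V)=B_1(\mathcal V)=B_2(\mathcal V)=0$, $B_3(\mathcal V)=\binom q3$, and $$B_w(\mathcal V)=A_w(\mathcal C)-(-1)^w\binom{q}{w}\binom{w-1}{2},\qquad w=4,5,\dots,q+1.$$ -/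

import Mathlib

open scoped LinearAlgebra.Projectivization

/-! ### Linear codes and their cosets -/

section Codes

variable {F : Type*} [Field F] [DecidableEq F] {n : ℕ}

/-- The linear code of length `n` with parity check matrix `H`. -/
def codeOfParityCheck {r : ℕ} (H : Matrix (Fin r) (Fin n) F) : Submodule F (Fin n → F) :=
  LinearMap.ker H.mulVecLin

/-- The minimum distance of a linear code: the least Hamming weight of a nonzero codeword. -/
noncomputable def codeMinDist (C : Submodule F (Fin n → F)) : ℕ :=
  sInf {w | ∃ c ∈ C, c ≠ 0 ∧ hammingNorm c = w}

/-- The covering radius: the least `R` such that the Hamming balls of radius `R` centred at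
the codewords cover the space. -/
noncomputable def coveringRadius (C : Submodule F (Fin n → F)) : ℕ :=
  sInf {R | ∀ x : Fin n → F, ∃ c ∈ C, hammingDist x c ≤ R}

/-- `A_w(C)`: the number of codewords of weight `w`. -/
noncomputable def codeWeightCount (C : Submodule F (Fin n → F)) (w : ℕ) : ℕ :=
  Set.ncard {c : Fin n → F | c ∈ C ∧ hammingNorm c = w}

/-- `B_w(V)`: the number of vectors of weight `w` in the coset `V` of `C`. -/
noncomputable def cosetWeightCount {C : Submodule F (Fin n → F)} (V : (Fin n → F) ⧸ C)
    (w : ℕ) : ℕ :=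
  Set.ncard {x : Fin n → F | Submodule.Quotient.mk x = V ∧ hammingNorm x = w}

/-- The weight of a coset: the least Hamming weight of a vector in it. -/
noncomputable def cosetWeight {C : Submodule F (Fin n → F)} (V : (Fin n → F) ⧸ C) : ℕ :=
  sInf {w | ∃ x : Fin n → F, Submodule.Quotient.mk x = V ∧ hammingNorm x = w}

end Codes

/-! ### Conics in the projective plane `PG(2,q)` -/

section Plane

variable {F : Type*} [Field F]

/-- The number of bisecants of the point set `S` that pass through the point `P`. A line is a
two-dimensional subspace of `F³`; it is a bisecant of `S` if it has exactly two points in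
common with `S`. -/
noncomputable def bisecantCount (S : Set (ℙ F (Fin 3 → F))) (P : ℙ F (Fin 3 → F)) : ℕ :=
  Set.ncard {L : Submodule F (Fin 3 → F) | Module.finrank F L = 2 ∧ P.submodule ≤ L ∧
    Set.ncard {Q : ℙ F (Fin 3 → F) | Q ∈ S ∧ Q.submodule ≤ L} = 2}

/-- Homogeneous coordinates `(1, t, t²)`, and `(0, 0, 1)` for the parameter at infinity. -/
def conicVector : Option F → (Fin 3 → F)
  | some t => ![1, t, t ^ 2]
  | none => ![0, 0, 1]

theorem conicVector_ne_zero (t : Option F) : conicVector t ≠ 0 := by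
  cases t with
  | none => intro h; simpa [conicVector] using congrFun h 2
  | some t => intro h; simpa [conicVector] using congrFun h 0

/-- The point set `{(1, t, t²) : t ∈ F} ∪ {(0, 0, 1)}` of `PG(2,q)`. -/
def standardConic (F : Type*) [Field F] : Set (ℙ F (Fin 3 → F)) :=
  Set.range fun t : Option F => Projectivization.mk F (conicVector t) (conicVector_ne_zero t)

/-- A conic: any point set projectively equivalent to `standardConic F`. -/
def IsConic (K : Set (ℙ F (Fin 3 → F))) : Prop :=
  ∃ g : (Fin 3 → F) ≃ₗ[F] (Fin 3 → F),
    K = Projectivization.map g.toLinearMap g.injective '' standardConic F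

/-- The `3 × (q+1)` matrix with columns `v i • (1, α i, (α i)²)` for `i < q`, followed by the
last column `v q • (0, 0, 1)`. -/
def gdrsMatrix {q : ℕ} (α : Fin q ≃ F) (v : Fin (q + 1) → Fˣ) :
    Matrix (Fin 3) (Fin (q + 1)) F :=
  Matrix.of fun r i => (v i : F) *
    (Fin.lastCases (conicVector none) (fun k => conicVector (some (α k))) i :
      Fin 3 → F) r

/-- The matrix `gdrsMatrix α v` with column `j` removed. -/
def shortenedMatrix {q : ℕ} (α : Fin q ≃ F) (v : Fin (q + 1) → Fˣ) (j : Fin (q + 1)) :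
    Matrix (Fin 3) (Fin q) F :=
  (gdrsMatrix α v).submatrix id j.succAbove

end Plane

/-- The sizes `N₁, N₂, N₃` of the three classes of points off a shortened conic. All the
divisions are exact. -/
def classSize (q : ℕ) : Fin 3 → ℕ :=
  if Odd q then ![(q ^ 2 + q) / 2, (q ^ 2 - q) / 2, 1] else ![q - 1, q ^ 2 - q, 2]

/-- The numbers `𝔹₁, 𝔹₂, 𝔹₃` of bisecants through a point of each class. All the divisions
are exact. -/
def classBisecants (q : ℕ) : Fin 3 → ℕ :=
  if Odd q then ![(q - 1) / 2, (q - 3) / 2, 0] else ![q / 2, (q - 2) / 2, 0]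

/-! A coset of the code is determined by its syndrome `s` in `F³`. When `s` is off the column
points, the coset has as many vectors of weight 2 as there are pairs of columns whose span contains
`s`. Hence the geometric and the coding statements rest on one count: for every vector off the
points, the number of `secantPairs`.

That count is made in coordinates. The conic is preserved by collineations that carry any chosen
point to infinity (`exists_linearEquiv_conicVector`), so the shortened conic becomes the set of all
`(1, t, t²)`. There the secant through the parameters `a ≠ b` has an equation symmetric in `a` and
`b`. Counting its ordered solutions amounts to counting the square roots of a discriminant if `s 0 ≠
0`, and to a linear equation if `s 0 = 0`. `conicVector_classes` collects the cases, and dividing by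
the `q - 1` nonzero scalars passes from vectors to points.

The weight formulas use only that any three columns are independent (`IsArc`). Inclusion–exclusion
over supports compares the vectors with syndrome `s` to the codewords. Three or more columns span
the whole space, so larger supports cancel and only those of size at most 2 contribute; the pairs
bring in the secant count (`IsArc.syndromeWeightCount_of_three_le`). -/

/-! ### Secants of a point set in terms of homogeneous coordinates -/

section Secants

variable {F : Type*} [Field F] {ι : Type*}

/-- The pairs of indices whose points span a line through the point with coordinates `s`. -/
def secantPairs (w : ι → Fin 3 → F) (s : Fin 3 → F) : Set (Finset ι) :=
  {T | T.card = 2 ∧ s ∈ Submodule.span F (w '' T)}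

/-- `s` is nonzero and not proportional to any of the vectors `w i`. -/
def OffPoints (w : ι → Fin 3 → F) (s : Fin 3 → F) : Prop :=
  s ≠ 0 ∧ ∀ i, s ∉ Submodule.span F {w i}

open scoped Classical in
/-- Counting unordered pairs by counting ordered ones. -/
theorem two_mul_ncard_pairs [Fintype ι] (p : Finset ι → Prop) :
    2 * Set.ncard {T : Finset ι | T.card = 2 ∧ p T} =
      Set.ncard {x : ι × ι | x.1 ≠ x.2 ∧ p {x.1, x.2}} := by
  rw [Set.ncard_eq_toFinset_card', Set.ncard_eq_toFinset_card', mul_comm]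
  symm
  rw [Finset.card_eq_sum_card_fiberwise (f := fun x : ι × ι => ({x.1, x.2} : Finset ι))
    (t := Set.toFinset {T : Finset ι | T.card = 2 ∧ p T})]
  · apply Finset.sum_const_nat
    intro T hT
    simp only [Set.mem_toFinset, Set.mem_ofPred_eq] at hT
    obtain ⟨a, b, hab, rfl⟩ := Finset.card_eq_two.1 hT.1
    rw [show (2 : ℕ) = ({(a, b), (b, a)} : Finset (ι × ι)).card from
      (Finset.card_pair (by simp [hab])).symm]
    congr 1
    ext ⟨x, y⟩
    simp only [Finset.mem_filter, Set.mem_toFinset, Set.mem_ofPred_eq, Finset.mem_insert,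
      Finset.mem_singleton, Prod.mk.injEq]
    constructor
    · rintro ⟨⟨hxy, -⟩, h⟩
      have hx : x ∈ ({a, b} : Finset ι) := h ▸ by simp
      have hy : y ∈ ({a, b} : Finset ι) := h ▸ by simp
      simp only [Finset.mem_insert, Finset.mem_singleton] at hx hy
      grind
    · rintro (⟨rfl, rfl⟩ | ⟨rfl, rfl⟩)
      · exact ⟨⟨hab, hT.2⟩, rfl⟩
      · rw [Finset.pair_comm]
        exact ⟨⟨hab.symm, hT.2⟩, rfl⟩
  · intro x hx
    simp only [Set.coe_toFinset, Set.mem_ofPred_eq] at hx ⊢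
    exact ⟨Finset.card_pair hx.1, hx.2⟩

/-- The coefficients of `(X - a)(X - b)` define a linear form vanishing at both points, and its
kernel is the line that joins them. -/
theorem mem_span_conicVector_pair {a b : F} (hab : a ≠ b) (s : Fin 3 → F) :
    s ∈ Submodule.span F {conicVector (some a), conicVector (some b)} ↔
      s 0 * a * b - s 1 * (a + b) + s 2 = 0 := by
  have hba : b - a ≠ 0 := sub_ne_zero.2 hab.symm
  rw [Submodule.mem_span_pair]
  constructor
  · rintro ⟨x, y, rfl⟩
    simp [conicVector]
    ring
  · intro h
    -- Cramer's rule on the first two coordinates; the third is then the hypothesis.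
    refine ⟨(s 0 * b - s 1) / (b - a), (s 1 - s 0 * a) / (b - a), ?_⟩
    funext i
    fin_cases i
    · simp [conicVector]; field_simp; ring
    · simp [conicVector]; field_simp; ring
    · simp [conicVector]; field_simp; linear_combination (a - b) * h

theorem mem_span_conicVector_singleton (a : F) (s : Fin 3 → F) :
    s ∈ Submodule.span F {conicVector (some a)} ↔ s 1 = s 0 * a ∧ s 2 = s 0 * a ^ 2 := by
  rw [Submodule.mem_span_singleton]
  constructor
  · rintro ⟨x, rfl⟩
    simp [conicVector]
  · rintro ⟨h1, h2⟩
    refine ⟨s 0, ?_⟩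
    funext i
    fin_cases i <;> simp [conicVector, h1, h2]

/-- Up to a nonzero square factor, the discriminant of `s 0 * X ^ 2 - 2 * s 1 * X + s 2`. -/
def conicDisc (s : Fin 3 → F) : F := (s 1 / s 0) ^ 2 - s 2 / s 0

/-- The line `s 0 = 0` is the tangent at the removed point `(0, 0, 1)` and contains no affine point
of the conic. Away from it, the discriminant vanishes exactly on the conic. The removed point itself
counts as off. -/
theorem offPoints_conicVector_iff (s : Fin 3 → F) :
    OffPoints (fun t : F => conicVector (some t)) s ↔
      (s 0 = 0 ∧ (s 1, s 2) ≠ 0) ∨ (s 0 ≠ 0 ∧ conicDisc s ≠ 0) := by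
  unfold OffPoints conicDisc
  simp only [mem_span_conicVector_singleton]
  by_cases h0 : s 0 = 0
  · have : s ≠ 0 ↔ (s 1, s 2) ≠ 0 := by
      rw [ne_eq, ne_eq, not_iff_not, funext_iff, Fin.forall_fin_succ]
      simp [h0, Fin.forall_fin_two, Prod.ext_iff]
    simp only [this, h0, zero_mul, true_and, not_true, false_and, or_false, ne_eq,
      and_iff_left_iff_imp]
    intro h i hi
    exact h (by simp [hi.1, hi.2])
  · have : s ≠ 0 := fun h => h0 (by simp [h])
    simp only [this, ne_eq, not_false_iff, true_and, h0, false_and, false_or]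
    constructor
    · intro h hd
      refine h (s 1 / s 0) ⟨by field_simp, ?_⟩
      rw [sub_eq_zero.1 hd]
      field_simp
    · rintro h i ⟨h1, h2⟩
      apply h
      rw [h1, h2]
      field_simp
      ring

end Secants

/-! ### Secant pairs through a vector, and vectors with given discriminant -/

section Counting

variable {F : Type*} [Field F] [Fintype F]

theorem ncard_ne {F : Type*} [Fintype F] (a : F) : Set.ncard {b : F | b ≠ a} = Fintype.card F - 1 := by
  classical
  have : {b : F | b ≠ a} = {a}ᶜ := rfl
  rw [this, Set.ncard_compl, Set.ncard_singleton, Nat.card_eq_fintype_card]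

theorem two_mul_ncard_secantPairs_conicVector (s : Fin 3 → F) :
    2 * (secantPairs (fun t : F => conicVector (some t)) s).ncard =
      Set.ncard {x : F × F | x.1 ≠ x.2 ∧
        s 0 * x.1 * x.2 - s 1 * (x.1 + x.2) + s 2 = 0} := by
  classical
  rw [secantPairs, two_mul_ncard_pairs
    (fun T : Finset F => s ∈ Submodule.span F ((fun t : F => conicVector (some t)) '' T))]
  congr 1
  ext x
  simp only [Set.mem_ofPred_eq]
  refine and_congr_right fun h => ?_
  rw [← mem_span_conicVector_pair h]
  simp [Set.image_pair]

/-- The secant equation becomes `a + b = s 2 / s 1`, so `a` determines `b`, and the pair degenerates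
when `2 * a` equals that quotient. The form `2 * a ≠ _` is kept because it serves both parities of
the characteristic. -/
theorem two_mul_ncard_secantPairs_of_eq_zero {s : Fin 3 → F} (h0 : s 0 = 0) (h1 : s 1 ≠ 0) :
    2 * (secantPairs (fun t : F => conicVector (some t)) s).ncard =
      Set.ncard {a : F | 2 * a ≠ s 2 / s 1} := by
  rw [two_mul_ncard_secantPairs_conicVector]
  have : {x : F × F | x.1 ≠ x.2 ∧ s 0 * x.1 * x.2 - s 1 * (x.1 + x.2) + s 2 = 0} =
      (fun a => (a, s 2 / s 1 - a)) '' {a : F | 2 * a ≠ s 2 / s 1} := by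
    ext ⟨a, b⟩
    simp only [Set.mem_ofPred_eq, Set.mem_image, Prod.mk.injEq, h0]
    constructor
    · rintro ⟨hab, h⟩
      have hb : s 2 / s 1 = a + b := by field_simp; linear_combination h
      refine ⟨a, ?_, rfl, by rw [hb]; ring⟩
      rw [hb]
      intro h'
      exact hab (by linear_combination h')
    · rintro ⟨c, hc, rfl, rfl⟩
      refine ⟨fun h' => hc (by linear_combination h'), by field_simp; ring⟩
  rw [this, Set.ncard_image_of_injective]
  intro a b h
  exact (Prod.mk.inj h).1

theorem ncard_secantPairs_eq_zero {s : Fin 3 → F} (h0 : s 0 = 0) (h1 : s 1 = 0) (h2 : s 2 ≠ 0) :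
    (secantPairs (fun t : F => conicVector (some t)) s).ncard = 0 := by
  have := two_mul_ncard_secantPairs_conicVector s
  simpa [h0, h1, h2] using this

/-- With `y = s 1 / s 0` the secant equation is the hyperbola `(a - y)(b - y) = d`, parametrized by
`u = a - y ≠ 0`. Its points with `a = b` are those with `u ^ 2 = d`, and these are discarded. -/
theorem two_mul_ncard_secantPairs_of_ne_zero {s : Fin 3 → F} (h0 : s 0 ≠ 0)
    (hd : conicDisc s ≠ 0) :
    2 * (secantPairs (fun t : F => conicVector (some t)) s).ncard + 1 +
      Set.ncard {u : F | u ^ 2 = conicDisc s} = Fintype.card F := by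
  rw [two_mul_ncard_secantPairs_conicVector]
  set d := conicDisc s with hdd
  set y := s 1 / s 0 with hy
  have h1 : s 1 = s 0 * y := by rw [hy]; field_simp
  have h2 : s 2 = s 0 * (y ^ 2 - d) := by rw [hdd, conicDisc, hy]; field_simp; ring
  have : {x : F × F | x.1 ≠ x.2 ∧ s 0 * x.1 * x.2 - s 1 * (x.1 + x.2) + s 2 = 0} =
      (fun u => (y + u, y + d / u)) '' ({0} ∪ {u : F | u ^ 2 = d})ᶜ := by
    ext ⟨a, b⟩
    simp only [Set.mem_ofPred_eq, Set.mem_image, Prod.mk.injEq, h1, h2, Set.mem_compl_iff,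
      Set.mem_union, Set.mem_singleton_iff, not_or]
    constructor
    · rintro ⟨hab, h⟩
      have h' : (a - y) * (b - y) = d := by
        apply mul_left_cancel₀ h0
        linear_combination h
      have ha : a - y ≠ 0 := by
        intro ha
        apply hd
        rw [← h', ha, zero_mul]
      refine ⟨a - y, ⟨ha, fun h3 => hab ?_⟩, by ring, by rw [← h']; field_simp; ring⟩
      rw [← h'] at h3
      have := mul_left_cancel₀ ha ((sq (a - y)).symm.trans h3)
      linear_combination this
    · rintro ⟨u, ⟨hu, hu'⟩, rfl, rfl⟩
      refine ⟨fun h' => hu' ?_, by field_simp; ring⟩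
      have : u = d / u := by linear_combination h'
      field_simp at this
      linear_combination this
  rw [this, Set.ncard_image_of_injective _ (fun a b h => add_left_cancel (Prod.mk.inj h).1),
    ← Nat.card_eq_fintype_card,
    ← Set.ncard_add_ncard_compl ({0} ∪ {u : F | u ^ 2 = d}), Set.ncard_union_eq (by
      simpa using hd.symm), Set.ncard_singleton]
  ring

/-- The set of vectors with prescribed `(s 1, s 2)` on `s 0 = 0` and prescribed discriminant
elsewhere. -/
theorem ncard_vectors (E : Set (F × F)) (Δ : Set F) :
    Set.ncard {s : Fin 3 → F | (s 0 = 0 ∧ (s 1, s 2) ∈ E) ∨ (s 0 ≠ 0 ∧ conicDisc s ∈ Δ)} =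
      E.ncard + (Fintype.card F - 1) * (Fintype.card F * Δ.ncard) := by
  have h1 : {s : Fin 3 → F | (s 0 = 0 ∧ (s 1, s 2) ∈ E) ∨ (s 0 ≠ 0 ∧ conicDisc s ∈ Δ)} =
      (fun p : F × F => ![0, p.1, p.2]) '' E ∪
      (fun p : F × F × F => ![p.1, p.1 * p.2.1, p.1 * (p.2.1 ^ 2 - p.2.2)]) ''
        ({x : F | x ≠ 0} ×ˢ (Set.univ ×ˢ Δ)) := by
    ext s
    simp only [Set.mem_ofPred_eq, Set.mem_union, Set.mem_image, Prod.exists, Set.mem_prod,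
      Set.mem_univ, true_and]
    refine or_congr ⟨?_, ?_⟩ ⟨?_, ?_⟩
    · rintro ⟨h0, h⟩
      refine ⟨s 1, s 2, h, ?_⟩
      funext i; fin_cases i <;> simp [h0]
    · rintro ⟨a, b, h, rfl⟩
      exact ⟨rfl, h⟩
    · rintro ⟨h0, h⟩
      refine ⟨s 0, s 1 / s 0, conicDisc s, ⟨h0, h⟩, ?_⟩
      funext i; fin_cases i
      · simp
      · simp; field_simp
      · simp [conicDisc]; field_simp
    · rintro ⟨x, y, d, ⟨hx, hd⟩, rfl⟩
      refine ⟨hx, ?_⟩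
      convert hd
      simp [conicDisc]
      field_simp
      ring
  rw [h1, Set.ncard_union_eq, Set.ncard_image_of_injective, Set.InjOn.ncard_image,
    Set.ncard_prod, Set.ncard_prod, Set.ncard_univ, Nat.card_eq_fintype_card,
    ncard_ne]
  · rintro ⟨x, y, d⟩ ⟨hx, -⟩ ⟨x', y', d'⟩ - h
    have e0 := congrFun h 0
    have e1 := congrFun h 1
    have e2 := congrFun h 2
    simp only [Set.mem_ofPred_eq] at hx
    simp at e0 e1 e2
    subst e0
    have e1 := mul_left_cancel₀ hx e1
    subst e1
    have e2 := sub_right_injective (mul_left_cancel₀ hx e2)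
    simp [e2]
  · rintro ⟨x, y⟩ ⟨x', y'⟩ h
    have e1 := congrFun h 1
    have e2 := congrFun h 2
    simp at e1 e2
    simp [e1, e2]
  · rw [Set.disjoint_left]
    rintro _ ⟨p, -, rfl⟩ ⟨p', hp', h⟩
    exact hp'.1 (congrFun h 0)

end Counting

/-! ### Square roots and squares in a finite field -/

section SquareCounts

variable {F : Type*} [Field F] [Fintype F]

theorem ncard_sqrts_of_isSquare {F : Type*} [Field F] (hF : ringChar F ≠ 2) {d : F} (hd : d ≠ 0) (h : IsSquare d) :
    Set.ncard {u : F | u ^ 2 = d} = 2 := by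
  obtain ⟨r, rfl⟩ := h
  have hr : r ≠ 0 := fun h => hd (by simp [h])
  have : {u : F | u ^ 2 = r * r} = {r, -r} := by
    ext u
    simp only [Set.mem_ofPred_eq, Set.mem_insert_iff, Set.mem_singleton_iff, ← sq]
    exact sq_eq_sq_iff_eq_or_eq_neg
  rw [this, Set.ncard_pair]
  intro h
  exact hr ((Ring.eq_self_iff_eq_zero_of_char_ne_two hF).1 h.symm)

theorem ncard_sqrts_of_not_isSquare {d : F} (h : ¬ IsSquare d) :
    Set.ncard {u : F | u ^ 2 = d} = 0 := by
  rw [Set.ncard_eq_zero, Set.eq_empty_iff_forall_notMem]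
  intro u hu
  exact h ⟨u, by rw [← sq]; exact hu.symm⟩

theorem ncard_sqrts_of_char_two (hF : ringChar F = 2) (d : F) :
    Set.ncard {u : F | u ^ 2 = d} = 1 := by
  have : CharP F 2 := ringChar.of_eq hF
  obtain ⟨r, hr⟩ := FiniteField.isSquare_of_char_two hF d
  rw [Set.ncard_eq_one]
  refine ⟨r, ?_⟩
  ext u
  simp only [Set.mem_ofPred_eq, Set.mem_singleton_iff, hr, ← sq]
  exact CharTwo.sq_inj

/-- The quadratic character is the difference of the indicators of nonzero squares and of
nonsquares, and it sums to zero. -/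
theorem ncard_squares_eq (hF : ringChar F ≠ 2) :
    2 * Set.ncard {d : F | ¬ IsSquare d} = Fintype.card F - 1 ∧
    2 * Set.ncard {d : F | d ≠ 0 ∧ IsSquare d} = Fintype.card F - 1 := by
  classical
  have key : ∀ d : F, quadraticChar F d =
      (if d ≠ 0 ∧ IsSquare d then 1 else 0) - (if ¬ IsSquare d then 1 else 0) := by
    intro d
    by_cases hd : d = 0
    · simp [hd]
    · by_cases hs : IsSquare d
      · simp [hd, hs, (quadraticChar_one_iff_isSquare hd).2 hs]
      · simp [hs, quadraticChar_neg_one_iff_not_isSquare.2 hs]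
  have h := quadraticChar_sum_zero hF
  simp only [key, Finset.sum_sub_distrib, Finset.sum_boole] at h
  have h2 : Set.ncard {d : F | ¬ IsSquare d} + Set.ncard {d : F | d ≠ 0 ∧ IsSquare d} =
      Fintype.card F - 1 := by
    rw [← ncard_ne (0 : F), ← Set.ncard_union_eq]
    · congr 1
      ext d
      by_cases hd : d = 0 <;> simp [hd, em']
    · rw [Set.disjoint_left]
      rintro a ha ⟨-, ha'⟩
      exact ha ha'
  rw [Set.ncard_eq_toFinset_card', Set.ncard_eq_toFinset_card', Set.toFinset_ofPred,
    Set.toFinset_ofPred] at h2 ⊢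
  omega

end SquareCounts

/-! ### The three classes for the affine part of the standard conic -/

section Classes

variable {F : Type*} [Field F] [Fintype F]

theorem ncard_prod_mem {F : Type*} (P Q : Set F) : Set.ncard {p : F × F | p.1 ∈ P ∧ p.2 ∈ Q} =
    P.ncard * Q.ncard := by
  rw [← Set.ncard_prod]
  rfl


/-- The number of bisecants determines the class, so classes can be defined by that number and are
automatically disjoint. For `q = 3` the last two values would coincide. -/
theorem classBisecants_injective {q : ℕ} (hq : 5 ≤ q) : Function.Injective (classBisecants q) := by
  intro i j hij
  unfold classBisecants at hij
  split_ifs at hij with ho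
  · obtain ⟨m, rfl⟩ := ho
    fin_cases i <;> fin_cases j <;> simp at hij ⊢ <;> omega
  · rw [Nat.not_odd_iff_even] at ho
    obtain ⟨m, rfl⟩ := ho
    fin_cases i <;> fin_cases j <;> simp at hij ⊢ <;> omega

/-- The sizes of the classes of vectors off the affine part of the standard conic. -/
theorem conicVector_classes {q : ℕ} (hcard : Fintype.card F = q) (hq : 5 ≤ q) :
    (∀ s, OffPoints (fun t : F => conicVector (some t)) s →
      ∃ k, (secantPairs (fun t : F => conicVector (some t)) s).ncard = classBisecants q k) ∧
    ∀ k, Set.ncard {s | OffPoints (fun t : F => conicVector (some t)) s ∧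
      (secantPairs (fun t : F => conicVector (some t)) s).ncard = classBisecants q k} =
        (q - 1) * classSize q k := by
  set c : F → Fin 3 → F := fun t => conicVector (some t) with hc
  -- A class is described by the pairs `(s 1, s 2)` it takes on the tangent at infinity (`E`) and by
  -- its discriminants elsewhere (`D`). Since the secant numbers are distinct, it is enough that
  -- these sets cover the nonzero values and give the right secant counts.
  suffices H : ∃ (E : Fin 3 → Set (F × F)) (D : Fin 3 → Set F),
      (∀ p, p ≠ 0 → ∃ k, p ∈ E k) ∧ (∀ d, d ≠ 0 → ∃ k, d ∈ D k) ∧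
      (∀ k, (0 : F × F) ∉ E k) ∧ (∀ k, (0 : F) ∉ D k) ∧
      (∀ k s, s 0 = 0 → (s 1, s 2) ∈ E k → (secantPairs c s).ncard = classBisecants q k) ∧
      (∀ k s, s 0 ≠ 0 → conicDisc s ∈ D k → (secantPairs c s).ncard = classBisecants q k) ∧
      (∀ k, (E k).ncard + (q - 1) * (q * (D k).ncard) = (q - 1) * classSize q k) by
    obtain ⟨E, D, hE, hD, hE0, hD0, hEs, hDs, hcount⟩ := H
    have hinj := classBisecants_injective hq
    constructor
    · intro s hs
      rcases (offPoints_conicVector_iff s).1 hs with ⟨h0, h⟩ | ⟨h0, h⟩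
      · obtain ⟨k, hk⟩ := hE _ h
        exact ⟨k, hEs k s h0 hk⟩
      · obtain ⟨k, hk⟩ := hD _ h
        exact ⟨k, hDs k s h0 hk⟩
    · intro k
      rw [← hcount k, ← hcard, ← ncard_vectors, hcard]
      congr 1
      ext s
      simp only [Set.mem_ofPred_eq]
      constructor
      · rintro ⟨hs, hN⟩
        rcases (offPoints_conicVector_iff s).1 hs with ⟨h0, h⟩ | ⟨h0, h⟩
        · obtain ⟨k', hk⟩ := hE _ h
          exact Or.inl ⟨h0, hinj ((hEs k' s h0 hk).symm.trans hN) ▸ hk⟩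
        · obtain ⟨k', hk⟩ := hD _ h
          exact Or.inr ⟨h0, hinj ((hDs k' s h0 hk).symm.trans hN) ▸ hk⟩
      · rintro (⟨h0, h⟩ | ⟨h0, h⟩)
        · refine ⟨(offPoints_conicVector_iff s).2 (Or.inl ⟨h0, fun h' => ?_⟩), hEs k s h0 h⟩
          exact hE0 k (h' ▸ h)
        · refine ⟨(offPoints_conicVector_iff s).2 (Or.inr ⟨h0, fun h' => ?_⟩), hDs k s h0 h⟩
          exact hD0 k (h' ▸ h)
  by_cases ho : Odd q
  · have hF : ringChar F ≠ 2 := by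
      intro h
      have := FiniteField.even_card_of_char_two h
      rw [hcard] at this
      rcases ho with ⟨m, rfl⟩
      omega
    obtain ⟨hn, hsq⟩ := ncard_squares_eq hF
    rw [hcard] at hn hsq
    -- Nonsquare discriminants (internal points) join the tangent at infinity minus the removed
    -- point; nonzero squares form the second class; the removed point is alone in the third.
    refine ⟨![{p | p.1 ≠ 0}, ∅, {p | p.1 = 0 ∧ p.2 ≠ 0}],
      ![{d | ¬ IsSquare d}, {d | d ≠ 0 ∧ IsSquare d}, ∅], ?_, ?_, ?_, ?_, ?_, ?_, ?_⟩
    · intro p hp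
      by_cases h1 : p.1 = 0
      · exact ⟨2, h1, fun h2 => hp (Prod.ext h1 h2)⟩
      · exact ⟨0, h1⟩
    · intro d hd
      by_cases h1 : IsSquare d
      · exact ⟨1, hd, h1⟩
      · exact ⟨0, h1⟩
    · intro k; fin_cases k <;> simp
    · intro k; fin_cases k <;> simp
    · intro k s h0 h
      simp only [classBisecants, ho, if_true]
      fin_cases k
      · have : 2 * (secantPairs c s).ncard = _ :=
          two_mul_ncard_secantPairs_of_eq_zero h0 h
        have h2 : (2 : F) ≠ 0 := Ring.two_ne_zero hF
        have e : {a : F | 2 * a ≠ s 2 / s 1} = {a : F | a ≠ s 2 / s 1 / 2} := by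
          ext a
          simp only [Set.mem_ofPred_eq, ne_eq, eq_div_iff h2, mul_comm]
        rw [e, ncard_ne, hcard] at this
        simp
        omega
      · simp at h
      · exact ncard_secantPairs_eq_zero h0 h.1 h.2
    · intro k s h0 h
      simp only [classBisecants, ho, if_true]
      fin_cases k
      · have hd : conicDisc s ≠ 0 := fun h' => h (h' ▸ IsSquare.zero)
        have : 2 * (secantPairs c s).ncard + 1 + _ = _ :=
          two_mul_ncard_secantPairs_of_ne_zero h0 hd
        rw [ncard_sqrts_of_not_isSquare h, hcard] at this
        simp
        omega
      · have : 2 * (secantPairs c s).ncard + 1 + _ = _ :=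
          two_mul_ncard_secantPairs_of_ne_zero h0 h.1
        rw [ncard_sqrts_of_isSquare hF h.1 h.2, hcard] at this
        simp
        omega
      · simp at h
    · have e0 : Set.ncard {p : F × F | p.1 ≠ 0} = (q - 1) * q := by
        have := ncard_prod_mem {x : F | x ≠ 0} Set.univ
        rw [ncard_ne, Set.ncard_univ, Nat.card_eq_fintype_card, hcard] at this
        simpa using this
      have e2 : Set.ncard {p : F × F | p.1 = 0 ∧ p.2 ≠ 0} = q - 1 := by
        have := ncard_prod_mem {(0 : F)} {x : F | x ≠ 0}
        rw [ncard_ne, Set.ncard_singleton, hcard] at this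
        simpa using this
      obtain ⟨m, rfl⟩ := ho
      intro k
      simp only [classSize, odd_two_mul_add_one, if_true]
      fin_cases k
      · simp only [Fin.zero_eta, Matrix.cons_val_zero]
        rw [e0, show Set.ncard {d : F | ¬ IsSquare d} = m by omega, ← Nat.mul_add]
        congr 1
        symm
        apply Nat.div_eq_of_eq_mul_left two_pos
        ring
      · simp only [Fin.mk_one, Matrix.cons_val_one, Matrix.cons_val_zero, Set.ncard_empty,
          zero_add]
        rw [show Set.ncard {d : F | d ≠ 0 ∧ IsSquare d} = m by omega]
        congr 1
        symm
        apply Nat.div_eq_of_eq_mul_left two_pos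
        apply Nat.sub_eq_of_eq_add
        ring
      · simp [e2]
  · have hev := Nat.not_odd_iff_even.1 ho
    have hF : ringChar F = 2 := by
      by_contra h
      have := FiniteField.odd_card_of_char_ne_two h
      rw [hcard] at this
      rcases hev with ⟨m, rfl⟩
      omega
    have : CharP F 2 := ringChar.of_eq hF
    -- Every discriminant has one square root, so all points off the tangent at infinity form the
    -- second class. On that tangent the removed point `(0, 0, 1)` and the nucleus `(0, 1, 0)` lie
    -- on no bisecant.
    refine ⟨![{p | p.1 ≠ 0 ∧ p.2 ≠ 0}, ∅, {p | p.1 = 0 ∧ p.2 ≠ 0} ∪ {p | p.1 ≠ 0 ∧ p.2 = 0}],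
      ![∅, {d | d ≠ 0}, ∅], ?_, ?_, ?_, ?_, ?_, ?_, ?_⟩
    · intro p hp
      by_cases h1 : p.1 = 0
      · exact ⟨2, Or.inl ⟨h1, fun h2 => hp (Prod.ext h1 h2)⟩⟩
      · by_cases h2 : p.2 = 0
        · exact ⟨2, Or.inr ⟨h1, h2⟩⟩
        · exact ⟨0, h1, h2⟩
    · intro d hd
      exact ⟨1, hd⟩
    · intro k; fin_cases k <;> simp
    · intro k; fin_cases k <;> simp
    · intro k s h0 h
      simp only [classBisecants, ho, if_false]
      fin_cases k
      · have : 2 * (secantPairs c s).ncard = _ :=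
          two_mul_ncard_secantPairs_of_eq_zero h0 h.1
        have e : {a : F | 2 * a ≠ s 2 / s 1} = Set.univ := by
          ext a
          simpa [CharTwo.two_eq_zero] using (div_ne_zero h.2 h.1).symm
        rw [e, Set.ncard_univ, Nat.card_eq_fintype_card, hcard] at this
        simp
        omega
      · simp at h
      · rcases h with h | h
        · exact ncard_secantPairs_eq_zero h0 h.1 h.2
        · have : 2 * (secantPairs c s).ncard = _ :=
          two_mul_ncard_secantPairs_of_eq_zero h0 h.1
          simpa [CharTwo.two_eq_zero, h.1, show s 2 = 0 from h.2] using this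
    · intro k s h0 h
      simp only [classBisecants, ho, if_false]
      fin_cases k
      · simp at h
      · have : 2 * (secantPairs c s).ncard + 1 + _ = _ :=
          two_mul_ncard_secantPairs_of_ne_zero h0 h
        rw [ncard_sqrts_of_char_two hF, hcard] at this
        simp
        omega
      · simp at h
    · have e0 : Set.ncard {p : F × F | p.1 ≠ 0 ∧ p.2 ≠ 0} = (q - 1) * (q - 1) := by
        have := ncard_prod_mem {x : F | x ≠ 0} {x : F | x ≠ 0}
        rw [ncard_ne, hcard] at this
        simpa using this
      have e2 : Set.ncard {p : F × F | p.1 = 0 ∧ p.2 ≠ 0} = q - 1 := by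
        have := ncard_prod_mem {(0 : F)} {x : F | x ≠ 0}
        rw [ncard_ne, Set.ncard_singleton, hcard] at this
        simpa using this
      have e3 : Set.ncard {p : F × F | p.1 ≠ 0 ∧ p.2 = 0} = q - 1 := by
        have := ncard_prod_mem {x : F | x ≠ 0} {(0 : F)}
        rw [ncard_ne, Set.ncard_singleton, hcard] at this
        simpa using this
      have hdisj : Disjoint {p : F × F | p.1 = 0 ∧ p.2 ≠ 0} {p : F × F | p.1 ≠ 0 ∧ p.2 = 0} := by
        rw [Set.disjoint_left]
        rintro p ⟨h, -⟩ ⟨h', -⟩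
        exact h' h
      intro k
      simp only [classSize, ho, if_false]
      fin_cases k
      · simp [e0]
      · simp only [Fin.mk_one, Matrix.cons_val_one, Matrix.cons_val_zero, Set.ncard_empty,
          zero_add]
        rw [ncard_ne, hcard, Nat.mul_sub, mul_one, sq]
      · simp [Set.ncard_union_eq hdisj, e2, e3]
        omega

end Classes

/-! ### Reduction of any shortened conic to the affine standard conic -/

section Frames

variable {F : Type*} [Field F] {ι : Type*}

/-- The vectors `w i` represent the affine points of a conic in suitable coordinates. -/
def IsConicFrame (w : ι → Fin 3 → F) : Prop :=
  ∃ (h : (Fin 3 → F) ≃ₗ[F] (Fin 3 → F)) (e : ι ≃ F) (u : ι → Fˣ),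
    ∀ i, w i = (u i : F) • h (conicVector (some (e i)))

/-- Every point of the standard conic can be moved to infinity by a collineation that preserves
the conic. -/
theorem exists_linearEquiv_conicVector (p : Option F) :
    ∃ h : (Fin 3 → F) ≃ₗ[F] (Fin 3 → F),
      ∀ r, r ≠ p → ∃ (t : F) (a : Fˣ), conicVector r = (a : F) • h (conicVector (some t)) := by
  cases p with
  | none =>
    refine ⟨LinearEquiv.refl _ _, fun r hr => ?_⟩
    obtain ⟨t, rfl⟩ := Option.ne_none_iff_exists'.1 hr
    exact ⟨t, 1, by simp⟩
  | some a =>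
    -- This map acts on parameters as `t ↦ a + 1 / t`, and multiplies the standard coordinates by `t
    -- ^ 2`; it sends infinity to `a` and `0` to infinity.
    refine ⟨
      { toFun := fun s => ![s 2, a * s 2 + s 1, a ^ 2 * s 2 + 2 * a * s 1 + s 0]
        invFun := fun s => ![s 2 - 2 * a * s 1 + a ^ 2 * s 0, s 1 - a * s 0, s 0]
        map_add' := fun s t => by funext i; fin_cases i <;> simp <;> ring
        map_smul' := fun c s => by funext i; fin_cases i <;> simp <;> ring
        left_inv := fun s => by funext i; fin_cases i <;> simp; ring
        right_inv := fun s => by funext i; fin_cases i <;> simp; ring }, fun r hr => ?_⟩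
    cases r with
    | none =>
      refine ⟨0, 1, ?_⟩
      funext i
      fin_cases i <;> simp [conicVector]
    | some b =>
      have hb : b - a ≠ 0 := fun h => hr (by rw [sub_eq_zero.1 h])
      refine ⟨(b - a)⁻¹, Units.mk0 ((b - a) ^ 2) (pow_ne_zero 2 hb), ?_⟩
      funext i
      fin_cases i
      · simp [conicVector]; field_simp
      · simp [conicVector]; field_simp; ring
      · simp [conicVector]; field_simp; ring

theorem eq_of_conicVector_eq_smul {r r' : Option F} {a : F}
    (h : conicVector r = a • conicVector r') : r = r' := by
  have h0 := congrFun h 0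
  have h1 := congrFun h 1
  have h2 := congrFun h 2
  cases r <;> cases r' <;> simp [conicVector] at h0 h1 h2 ⊢
  · simp [← h0] at h2
  · rw [← h0] at h1
    simpa using h1

/-- Once `p` is at infinity, the other points have affine parameters. The parameter map is injective
between sets of equal size, hence bijective. This serves both a conic minus a point and the columns
of the shortened matrix. -/
theorem isConicFrame_of_conicVector [Fintype F] [Finite ι] (hcard : Nat.card ι = Fintype.card F)
    (g : (Fin 3 → F) ≃ₗ[F] (Fin 3 → F)) (p : Option F) {ρ : ι → Option F}
    (hρ : Function.Injective ρ) (hp : ∀ i, ρ i ≠ p) (a : ι → Fˣ) {w : ι → Fin 3 → F}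
    (hw : ∀ i, w i = (a i : F) • g (conicVector (ρ i))) : IsConicFrame w := by
  obtain ⟨h, hh⟩ := exists_linearEquiv_conicVector p
  choose t b htb using fun i => hh (ρ i) (hp i)
  have hinj : Function.Injective t := by
    intro i j hij
    apply hρ
    refine eq_of_conicVector_eq_smul (a := (b i : F) * (b j : F)⁻¹) ?_
    rw [htb i, htb j, hij, smul_smul, mul_assoc, inv_mul_cancel₀ (b j).ne_zero, mul_one]
  have hbij := (Nat.bijective_iff_injective_and_card t).2
    ⟨hinj, by rw [hcard, Nat.card_eq_fintype_card]⟩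
  refine ⟨h.trans g, Equiv.ofBijective t hbij, fun i => a i * b i, fun i => ?_⟩
  rw [hw, htb]
  simp [smul_smul]

/-- Any three of the points are independent. -/
def IsArc (w : ι → Fin 3 → F) : Prop :=
  ∀ T : Finset ι, T.card ≤ 3 → LinearIndepOn F w (T : Set ι)

theorem linearIndependent_conicVector {f : Fin 3 → F} (hf : Function.Injective f) :
    LinearIndependent F fun i => conicVector (some (f i)) := by
  have := Matrix.linearIndependent_rows_of_det_ne_zero (Matrix.det_vandermonde_ne_zero_iff.2 hf)
  have h : (fun i => conicVector (some (f i))) = Matrix.vandermonde f := by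
    funext i j
    fin_cases j <;> simp [conicVector, Matrix.vandermonde]
  rw [h]
  exact this

theorem IsConicFrame.isArc [Fintype ι] (hι : 3 ≤ Fintype.card ι) {w : ι → Fin 3 → F}
    (hw : IsConicFrame w) : IsArc w := by
  classical
  obtain ⟨h, e, u, hw⟩ := hw
  intro T hT
  -- The Vandermonde determinant needs exactly three indices, so smaller sets are enlarged first.
  obtain ⟨T', hTT', hT'⟩ := Finset.exists_superset_card_eq hT (by simpa using hι)
  refine LinearIndepOn.mono ?_ (Finset.coe_subset.2 hTT')
  let f := (Finset.equivFinOfCardEq hT').symm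
  have h1 := (linearIndependent_conicVector (F := F) (f := fun i => e (f i)) (fun i j hij =>
    f.injective (Subtype.ext (e.injective hij)))).map' h.toLinearMap h.ker
  have h2 := h1.units_smul (fun i => u (f i))
  have h3 := (linearIndependent_equiv f.symm).2 h2
  have h4 : (fun i : (T' : Set ι) => w i) = ((fun i => u ↑(f i)) •
      (h.toLinearMap ∘ fun i => conicVector (some (e (f i))))) ∘ f.symm := by
    funext i
    have : f (f.symm i) = i := f.apply_symm_apply i
    simp only [hw, Units.smul_def, Function.comp_apply, Pi.smul_apply', this]
    rfl
  change LinearIndependent F (fun i : (T' : Set ι) => w i)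
  rw [h4]
  exact h3

/-- Spans ignore the unit factors and commute with linear maps, so every condition phrased through
spans transfers to the standard conic. -/
theorem span_image_conicFrame {w : ι → Fin 3 → F} {h : (Fin 3 → F) ≃ₗ[F] (Fin 3 → F)} {e : ι ≃ F}
    {u : ι → Fˣ} (hw : ∀ i, w i = (u i : F) • h (conicVector (some (e i)))) (T : Set ι) :
    Submodule.span F (w '' T) =
      (Submodule.span F ((fun t : F => conicVector (some t)) '' (e '' T))).map h.toLinearMap := by
  rw [Submodule.map_span]
  apply le_antisymm
  · rw [Submodule.span_le]
    rintro _ ⟨i, hi, rfl⟩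
    rw [hw]
    exact Submodule.smul_mem _ _ (Submodule.subset_span ⟨_, ⟨_, ⟨i, hi, rfl⟩, rfl⟩, rfl⟩)
  · rw [Submodule.span_le]
    rintro _ ⟨_, ⟨_, ⟨i, hi, rfl⟩, rfl⟩, rfl⟩
    have : h (conicVector (some (e i))) = (↑(u i)⁻¹ : F) • w i := by
      rw [hw, smul_smul, Units.inv_mul, one_smul]
    change h (conicVector (some (e i))) ∈ _
    rw [this]
    exact Submodule.smul_mem _ _ (Submodule.subset_span ⟨i, hi, rfl⟩)

/-- The sizes of the classes of vectors off the points of a conic frame. -/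
theorem IsConicFrame.classes [Fintype F] {q : ℕ} (hcard : Fintype.card F = q) (hq : 5 ≤ q)
    {w : ι → Fin 3 → F} (hw : IsConicFrame w) :
    (∀ s, OffPoints w s → ∃ k, (secantPairs w s).ncard = classBisecants q k) ∧
    ∀ k, Set.ncard {s | OffPoints w s ∧ (secantPairs w s).ncard = classBisecants q k} =
      (q - 1) * classSize q k := by
  obtain ⟨h, e, u, hw⟩ := hw
  have hspan := span_image_conicFrame hw
  have hoff : ∀ s, OffPoints w (h s) ↔ OffPoints (fun t : F => conicVector (some t)) s := by
    intro s
    unfold OffPoints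
    refine and_congr (by simp) (Iff.trans (forall_congr' fun i => not_congr ?_)
      (e.forall_congr_left (p := fun i => s ∉ Submodule.span F {conicVector (some (e i))})
        |>.trans (by simp)))
    have := hspan {i}
    simp only [Set.image_singleton] at this
    rw [this]
    simp
  have hsec : ∀ s, (secantPairs w (h s)).ncard =
      (secantPairs (fun t : F => conicVector (some t)) s).ncard := by
    intro s
    rw [← Set.ncard_image_of_injective (secantPairs w (h s)) (Finset.map_injective e.toEmbedding)]
    congr 1
    ext T
    obtain ⟨T, rfl⟩ := e.finsetCongr.surjective T
    simp only [secantPairs, Equiv.finsetCongr_apply, Set.mem_image, Set.mem_ofPred_eq,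
      Finset.card_map, Finset.coe_map, Equiv.coe_toEmbedding]
    constructor
    · rintro ⟨T', hT', h'⟩
      obtain rfl := Finset.map_injective _ h'
      refine ⟨hT'.1, ?_⟩
      have := hT'.2
      rw [hspan] at this
      simpa using this
    · rintro ⟨h1, h2⟩
      refine ⟨T, ⟨h1, ?_⟩, rfl⟩
      rw [hspan]
      simpa using h2
  obtain ⟨h1, h2⟩ := conicVector_classes hcard hq
  constructor
  · intro s hs
    obtain ⟨s, rfl⟩ := h.surjective s
    rw [hsec]
    exact h1 s ((hoff s).1 hs)
  · intro k
    rw [← h2 k, ← Set.ncard_image_of_injective {s | OffPoints (fun t : F => conicVector (some t)) s ∧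
      (secantPairs (fun t : F => conicVector (some t)) s).ncard = classBisecants q k} h.injective]
    congr 1
    ext s
    obtain ⟨s, rfl⟩ := h.surjective s
    rw [h.injective.mem_set_image]
    simp only [Set.mem_ofPred_eq, hoff, hsec]

end Frames

/-! ### From vectors and index pairs to points and bisecants -/

section Points

variable {F : Type*} [Field F] {ι : Type*}

theorem IsArc.ne_zero {w : ι → Fin 3 → F} (hw : IsArc w) (i : ι) : w i ≠ 0 := by
  have := hw {i} (by simp)
  simpa using this

/-- Adjoining a new index to `T` still leaves at most three vectors, which are independent. In
particular a secant meets the arc only in its two defining points. -/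
theorem IsArc.mem_span_iff {w : ι → Fin 3 → F} (hw : IsArc w) {T : Finset ι} (hT : T.card ≤ 2)
    (i : ι) : w i ∈ Submodule.span F (w '' T) ↔ i ∈ T := by
  classical
  refine ⟨fun h => ?_, fun h => Submodule.subset_span ⟨i, h, rfl⟩⟩
  by_contra hi
  have h1 := hw (insert i T) (by rw [Finset.card_insert_of_notMem hi]; omega)
  rw [Finset.coe_insert, linearIndepOn_insert (by simpa using hi)] at h1
  exact h1.2 h

theorem IsArc.finrank_span {w : ι → Fin 3 → F} (hw : IsArc w) {T : Finset ι} (hT : T.card ≤ 3) :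
    Module.finrank F (Submodule.span F (w '' T)) = T.card := by
  have h := hw T hT
  have := finrank_span_eq_card h
  rw [← Set.image_eq_range] at this
  simpa using this

theorem IsArc.mk_injective {w : ι → Fin 3 → F} (hw : IsArc w) :
    Function.Injective fun i => Projectivization.mk F (w i) (hw.ne_zero i) := by
  intro i j hij
  have h := (Projectivization.mk_eq_mk_iff' F _ _ (hw.ne_zero i) (hw.ne_zero j)).1 hij
  have := hw.mem_span_iff (T := {j}) (by simp) i
  simp only [Finset.coe_singleton, Set.image_singleton, Finset.mem_singleton,
    Submodule.mem_span_singleton] at this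
  exact this.1 h

theorem offPoints_iff {w : ι → Fin 3 → F} (hw : IsArc w) {s : Fin 3 → F} (hs : s ≠ 0) :
    OffPoints w s ↔ Projectivization.mk F s hs ∉
      Set.range fun i => Projectivization.mk F (w i) (hw.ne_zero i) := by
  simp only [OffPoints, hs, ne_eq, not_false_iff, true_and, Set.mem_range, not_exists]
  refine forall_congr' fun i => not_congr ?_
  rw [eq_comm, Projectivization.mk_eq_mk_iff', Submodule.mem_span_singleton]

/-- Lines that meet an arc in two points correspond to pairs of points of the arc. -/
theorem bisecantCount_eq [Finite ι] {w : ι → Fin 3 → F} (hw : IsArc w) {s : Fin 3 → F}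
    (hs : s ≠ 0) :
    bisecantCount (Set.range fun i => Projectivization.mk F (w i) (hw.ne_zero i))
      (Projectivization.mk F s hs) = (secantPairs w s).ncard := by
  classical
  have := Fintype.ofFinite ι
  have hL : ∀ L : Submodule F (Fin 3 → F),
      Set.ncard {Q | Q ∈ (Set.range fun i => Projectivization.mk F (w i) (hw.ne_zero i)) ∧
        Q.submodule ≤ L} = (Finset.univ.filter fun i => w i ∈ L).card := by
    intro L
    rw [← Set.ncard_coe_finset, ← Set.ncard_image_of_injective _ hw.mk_injective]
    congr 1
    ext Q
    simp only [Set.mem_ofPred_eq, Set.mem_range, Finset.coe_filter, Finset.mem_univ, true_and,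
      Set.mem_image]
    constructor
    · rintro ⟨⟨i, rfl⟩, h⟩
      rw [Projectivization.submodule_mk, Submodule.span_singleton_le_iff_mem] at h
      exact ⟨i, h, rfl⟩
    · rintro ⟨i, h, rfl⟩
      rw [Projectivization.submodule_mk, Submodule.span_singleton_le_iff_mem]
      exact ⟨⟨i, rfl⟩, h⟩
  have hfilter : ∀ T : Finset ι, T.card = 2 →
      (Finset.univ.filter fun i => w i ∈ Submodule.span F (w '' T)) = T := by
    intro T hT
    ext i
    simp [hw.mem_span_iff hT.le]
  unfold bisecantCount secantPairs
  symm
  refine Set.ncard_congr (fun T _ => Submodule.span F (w '' T)) ?_ ?_ ?_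
  · rintro T ⟨hT, hsT⟩
    refine ⟨by rw [hw.finrank_span (by omega), hT], ?_, ?_⟩
    · rwa [Projectivization.submodule_mk, Submodule.span_singleton_le_iff_mem]
    · rw [hL, hfilter T hT, hT]
  · rintro T T' ⟨hT, -⟩ ⟨hT', -⟩ h
    rw [← hfilter T hT, ← hfilter T' hT', h]
  · rintro L ⟨hL2, hsL, hcard⟩
    rw [hL] at hcard
    -- A bisecant is recovered from its two arc points, whose span lies in it and has the same
    -- dimension.
    have hle : Submodule.span F (w '' (Finset.univ.filter fun i => w i ∈ L : Finset ι)) ≤ L := by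
      rw [Submodule.span_le]
      rintro _ ⟨i, hi, rfl⟩
      simpa using hi
    have heq := Submodule.eq_of_le_of_finrank_eq hle (by
      rw [hw.finrank_span (by omega), hcard, hL2])
    refine ⟨_, ⟨hcard, ?_⟩, heq⟩
    rw [heq]
    rwa [Projectivization.submodule_mk, Submodule.span_singleton_le_iff_mem] at hsL

/-- Each point of a projective space has `q - 1` representatives. -/
theorem ncard_representatives [Fintype F] {V : Type*} [AddCommGroup V] [Module F V] [Finite V]
    (A : Set (ℙ F V)) :
    Set.ncard {v : V | ∃ hv : v ≠ 0, Projectivization.mk F v hv ∈ A} =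
      (Fintype.card F - 1) * A.ncard := by
  classical
  have h : {v : V | ∃ hv : v ≠ 0, Projectivization.mk F v hv ∈ A} =
      (fun x : Fˣ × ℙ F V => x.1 • x.2.rep) '' (Set.univ ×ˢ A) := by
    ext v
    constructor
    · rintro ⟨hv, hA⟩
      obtain ⟨a, ha⟩ := Projectivization.exists_smul_eq_mk_rep F v hv
      refine ⟨(a⁻¹, _), ⟨trivial, hA⟩, ?_⟩
      change a⁻¹ • (Projectivization.mk F v hv).rep = v
      rw [← ha, inv_smul_smul]
    · rintro ⟨⟨a, Q⟩, ⟨-, hQ⟩, rfl⟩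
      have hne : a • Q.rep ≠ 0 := (smul_ne_zero_iff_ne a).2 Q.rep_nonzero
      refine ⟨hne, ?_⟩
      convert hQ
      conv_rhs => rw [← Q.mk_rep]
      rw [Projectivization.mk_eq_mk_iff]
      exact ⟨a, rfl⟩
  rw [h, Set.ncard_image_of_injective, Set.ncard_prod, Set.ncard_univ, Nat.card_eq_fintype_card,
    Fintype.card_units]
  rintro ⟨a, Q⟩ ⟨b, R⟩ hab
  have hab : a • Q.rep = b • R.rep := hab
  have hQR : Q = R := by
    rw [← Q.mk_rep, ← R.mk_rep, Projectivization.mk_eq_mk_iff]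
    exact ⟨a⁻¹ * b, by rw [mul_smul, ← hab, inv_smul_smul]⟩
  subst hQR
  have : (a : F) • Q.rep = (b : F) • Q.rep := hab
  rw [Units.ext (smul_left_injective F Q.rep_nonzero this)]

/-- The points off the affine part of a conic, classified by the number of bisecants. -/
theorem IsConicFrame.point_classes [Fintype F] [Fintype ι] {q : ℕ} (hcard : Fintype.card F = q)
    (hq : 5 ≤ q) (hι : Fintype.card ι = q) {w : ι → Fin 3 → F} (hw : IsConicFrame w)
    (harc : IsArc w) {S : Set (ℙ F (Fin 3 → F))}
    (hS : S = Set.range fun i => Projectivization.mk F (w i) (harc.ne_zero i)) :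
    Sᶜ.ncard = q ^ 2 + 1 ∧
      ∃ A : Fin 3 → Set (ℙ F (Fin 3 → F)),
        Pairwise (fun i j => Disjoint (A i) (A j)) ∧
        (⋃ j, A j) = Sᶜ ∧
        ∀ j, Set.ncard (A j) = classSize q j ∧
          ∀ Q ∈ A j, bisecantCount S Q = classBisecants q j := by
  have hinj := classBisecants_injective hq
  subst hS
  set S := Set.range fun i => Projectivization.mk F (w i) (harc.ne_zero i) with hS
  obtain ⟨h1, h2⟩ := hw.classes hcard hq
  refine ⟨?_, fun j => {Q | Q ∉ S ∧ bisecantCount S Q = classBisecants q j}, ?_, ?_, ?_⟩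
  · have e1 : S.ncard = q := by
      rw [hS, ← Set.image_univ, Set.ncard_image_of_injective _ harc.mk_injective, Set.ncard_univ,
        Nat.card_eq_fintype_card, hι]
    have e2 := Projectivization.card_of_finrank F (Fin 3 → F) (n := 3) (by simp)
    rw [Set.ncard_compl, e1, e2, Nat.card_eq_fintype_card, hcard]
    simp [Finset.sum_range_succ]
    omega
  · intro i j hij
    rw [Set.disjoint_left]
    rintro Q ⟨-, hi⟩ ⟨-, hj⟩
    exact hij (hinj (hi.symm.trans hj))
  · ext Q
    simp only [Set.mem_iUnion, Set.mem_ofPred_eq, Set.mem_compl_iff]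
    refine ⟨fun ⟨_, h, _⟩ => h, fun h => ?_⟩
    induction Q using Projectivization.ind with
    | h s hs =>
      obtain ⟨k, hk⟩ := h1 s ((offPoints_iff harc hs).2 h)
      exact ⟨k, h, (bisecantCount_eq harc hs).trans hk⟩
  · intro j
    refine ⟨?_, fun Q hQ => hQ.2⟩
    -- The class sizes are known for vectors; each point accounts for `q - 1` of them.
    apply Nat.eq_of_mul_eq_mul_left (show 0 < q - 1 by omega)
    rw [← h2 j, ← hcard, ← ncard_representatives, hcard]
    congr 1
    ext s
    constructor
    · rintro ⟨hs, hsS, hb⟩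
      exact ⟨(offPoints_iff harc hs).2 hsS, (bisecantCount_eq harc hs).symm.trans hb⟩
    · rintro ⟨hs, hN⟩
      exact ⟨hs.1, (offPoints_iff harc hs.1).1 hs, (bisecantCount_eq harc hs.1).trans hN⟩

/-- A conic without one of its points, in terms of homogeneous coordinates. -/
theorem IsConic.exists_frame [Fintype F] (hF : 3 ≤ Fintype.card F) {K : Set (ℙ F (Fin 3 → F))}
    {P : ℙ F (Fin 3 → F)} (hK : IsConic K) (hP : P ∈ K) :
    ∃ (w : F → Fin 3 → F) (_ : IsConicFrame w) (harc : IsArc w),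
      K \ {P} = Set.range fun i => Projectivization.mk F (w i) (harc.ne_zero i) := by
  classical
  obtain ⟨g, rfl⟩ := hK
  obtain ⟨_, ⟨p, rfl⟩, rfl⟩ := hP
  let ρ : F ≃ {r : Option F // r ≠ p} := Fintype.equivOfCardEq (by simp)
  have hw : IsConicFrame fun i => g (conicVector (ρ i : Option F)) :=
    isConicFrame_of_conicVector (by simp) g p (ρ := fun i => ρ i)
      (fun i j h => ρ.injective (Subtype.ext h)) (fun i => (ρ i).2) (fun _ => 1) (by simp)
  refine ⟨_, hw, hw.isArc hF, ?_⟩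
  ext Q
  constructor
  · rintro ⟨⟨_, ⟨r, rfl⟩, rfl⟩, hr⟩
    have hrp : r ≠ p := by
      rintro rfl
      exact hr rfl
    refine ⟨ρ.symm ⟨r, hrp⟩, ?_⟩
    simp [Projectivization.map_mk]
  · rintro ⟨i, rfl⟩
    refine ⟨⟨_, ⟨ρ i, rfl⟩, ?_⟩, ?_⟩
    · simp [Projectivization.map_mk]
    · intro h
      simp only [Set.mem_singleton_iff, Projectivization.map_mk, Projectivization.mk_eq_mk_iff'] at h
      obtain ⟨a, ha⟩ := h
      refine (ρ i).2 (eq_of_conicVector_eq_smul (a := a) (g.injective ?_))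
      rw [map_smul]
      exact ha.symm

end Points

/-! ### Weight counts by inclusion–exclusion over supports -/

section Syndromes

variable {F : Type*} [Field F] [DecidableEq F] {ι : Type*} [Fintype ι] [DecidableEq ι]

/-- The set of indices of the nonzero coordinates. -/
def coordSupport (x : ι → F) : Finset ι := {i | x i ≠ 0}

omit [DecidableEq ι] in
theorem card_coordSupport (x : ι → F) : (coordSupport x).card = hammingNorm x := rfl

/-- The vectors with syndrome `s` that are supported in `T`. -/
def solutionsIn (w : ι → Fin 3 → F) (s : Fin 3 → F) (T : Finset ι) : Set (ι → F) :=
  {x | Fintype.linearCombination F w x = s ∧ coordSupport x ⊆ T}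

/-- The number of vectors of weight `k` with syndrome `s`. -/
noncomputable def syndromeWeightCount (w : ι → Fin 3 → F) (s : Fin 3 → F) (k : ℕ) : ℕ :=
  Set.ncard {x | Fintype.linearCombination F w x = s ∧ hammingNorm x = k}

omit [DecidableEq ι] in
theorem linearCombination_eq_sum_of_subset (w : ι → Fin 3 → F) {x : ι → F} {T : Finset ι}
    (hx : coordSupport x ⊆ T) :
    Fintype.linearCombination F w x = ∑ i ∈ T, x i • w i := by
  rw [Fintype.linearCombination_apply]
  symm
  apply Finset.sum_subset (Finset.subset_univ T)
  intro i _ hi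
  have : x i = 0 := by
    by_contra h
    exact hi (hx (by simpa [coordSupport] using h))
  simp [this]

/-- This is the link between the code and the geometry: solvability on a support is incidence with a
span. -/
theorem solutionsIn_nonempty_iff (w : ι → Fin 3 → F) (s : Fin 3 → F) (T : Finset ι) :
    (solutionsIn w s T).Nonempty ↔ s ∈ Submodule.span F (w '' T) := by
  rw [Submodule.mem_span_image_finset_iff_exists_fun']
  constructor
  · rintro ⟨x, hx, hT⟩
    exact ⟨x, by rw [← hx, linearCombination_eq_sum_of_subset w hT]⟩
  · rintro ⟨c, hc⟩
    have hsub : coordSupport (fun i => if i ∈ T then c i else 0) ⊆ T := by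
      intro i hi
      by_contra h
      simp [coordSupport, h] at hi
    refine ⟨fun i => if i ∈ T then c i else 0, ?_, hsub⟩
    rw [linearCombination_eq_sum_of_subset w hsub, ← hc]
    exact Finset.sum_congr rfl fun i hi => by simp [hi]

omit [DecidableEq ι] in
theorem IsArc.solutionsIn_subsingleton {w : ι → Fin 3 → F} (hw : IsArc w) (s : Fin 3 → F)
    {T : Finset ι} (hT : T.card ≤ 3) : (solutionsIn w s T).Subsingleton := by
  rintro x ⟨hx, hxT⟩ y ⟨hy, hyT⟩
  have h := linearIndepOn_finset_iffₛ.1 (hw T hT) x y (by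
    rw [← linearCombination_eq_sum_of_subset w hxT, ← linearCombination_eq_sum_of_subset w hyT,
      hx, hy])
  funext i
  by_cases hi : i ∈ T
  · exact h i hi
  · have h1 : x i = 0 := by
      by_contra h
      exact hi (hxT (by simpa [coordSupport] using h))
    have h2 : y i = 0 := by
      by_contra h
      exact hi (hyT (by simpa [coordSupport] using h))
    rw [h1, h2]

open scoped Classical in
theorem IsArc.ncard_solutionsIn {w : ι → Fin 3 → F} (hw : IsArc w) (s : Fin 3 → F)
    {T : Finset ι} (hT : T.card ≤ 3) :
    (solutionsIn w s T).ncard = if s ∈ Submodule.span F (w '' T) then 1 else 0 := by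
  rw [← solutionsIn_nonempty_iff]
  rcases (hw.solutionsIn_subsingleton s hT).eq_empty_or_singleton with h | ⟨x, h⟩ <;> simp [h]

omit [DecidableEq F] [Fintype ι] [DecidableEq ι] in
theorem IsArc.mem_span {w : ι → Fin 3 → F} (hw : IsArc w) (s : Fin 3 → F)
    {T : Finset ι} (hT : 3 ≤ T.card) : s ∈ Submodule.span F (w '' T) := by
  obtain ⟨T', hT', h3⟩ := Finset.exists_subset_card_eq hT
  have h := hw.finrank_span h3.le
  have htop : Submodule.span F (w '' T') = ⊤ := by
    apply Submodule.eq_top_of_finrank_eq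
    rw [h, h3]
    simp
  exact Submodule.span_mono (Set.image_mono (Finset.coe_subset.2 hT')) (htop ▸ Submodule.mem_top)

theorem coordSupport_add_subset {x y : ι → F} {T : Finset ι} (hx : coordSupport x ⊆ T)
    (hy : coordSupport y ⊆ T) : coordSupport (x + y) ⊆ T := by
  intro i hi
  by_contra h
  have h1 : x i = 0 := by
    by_contra h'
    exact h (hx (by simpa [coordSupport] using h'))
  have h2 : y i = 0 := by
    by_contra h'
    exact h (hy (by simpa [coordSupport] using h'))
  simp [coordSupport, h1, h2] at hi

/-- Three columns already span `F³`, so the system is solvable and its solutions are a translate of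
the homogeneous ones. Hence such supports cancel when `s` is compared with `0`. -/
theorem IsArc.ncard_solutionsIn_of_three_le {w : ι → Fin 3 → F} (hw : IsArc w)
    (s : Fin 3 → F) {T : Finset ι} (hT : 3 ≤ T.card) :
    (solutionsIn w s T).ncard = (solutionsIn w 0 T).ncard := by
  obtain ⟨x, hx, hxT⟩ := (solutionsIn_nonempty_iff w s T).2 (hw.mem_span s hT)
  have hneg : coordSupport (-x) ⊆ T := by
    intro i hi
    exact hxT (by simpa [coordSupport] using hi)
  have : solutionsIn w s T = (x + ·) '' solutionsIn w 0 T := by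
    ext y
    constructor
    · rintro ⟨hy, hyT⟩
      exact ⟨-x + y, ⟨by simp [map_add, hx, hy], coordSupport_add_subset hneg hyT⟩, by simp⟩
    · rintro ⟨z, ⟨hz, hzT⟩, rfl⟩
      exact ⟨by simp [map_add, hx, hz], coordSupport_add_subset hxT hzT⟩
  rw [this, Set.ncard_image_of_injective _ (add_right_injective x)]

omit [Fintype ι] in
/-- Möbius inversion on the subsets of `S`. -/
theorem sum_powerset_neg_one_pow_subset (A S : Finset ι) :
    ∑ T ∈ S.powerset, (-1 : ℤ) ^ (S \ T).card * (if A ⊆ T then 1 else 0) =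
      if A = S then 1 else 0 := by
  by_cases hA : A ⊆ S
  · have h1 : ∏ i ∈ S, ((1 : ℤ) + if i ∉ A then -1 else 0) = if A = S then 1 else 0 := by
      have : ∀ i, ((1 : ℤ) + if i ∉ A then -1 else 0) = if i ∈ A then 1 else 0 := by
        intro i
        by_cases hi : i ∈ A <;> simp [hi]
      rw [Finset.prod_congr rfl fun i _ => this i, Finset.prod_boole]
      congr 1
      exact propext ⟨fun h => hA.antisymm h, fun h => by simp [h]⟩
    rw [← h1, Finset.prod_add]
    refine Finset.sum_congr rfl fun T hT => ?_
    rw [Finset.prod_const_one, one_mul]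
    by_cases hAT : A ⊆ T
    · rw [if_pos hAT, mul_one, ← Finset.prod_const]
      refine Finset.prod_congr rfl fun i hi => ?_
      rw [if_pos fun h => (Finset.mem_sdiff.1 hi).2 (hAT h)]
    · rw [if_neg hAT, mul_zero]
      obtain ⟨i, hiA, hiT⟩ := Finset.not_subset.1 hAT
      symm
      exact Finset.prod_eq_zero (Finset.mem_sdiff.2 ⟨hA hiA, hiT⟩) (by simp [hiA])
  · rw [if_neg (fun h => hA h.subset)]
    refine Finset.sum_eq_zero fun T hT => ?_
    rw [if_neg fun h => hA (h.trans (Finset.mem_powerset.1 hT)), mul_zero]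

variable [Fintype F]

/-- The indicator of support exactly `S` is replaced by its Möbius expansion, and the two sums are
exchanged. -/
theorem ncard_eq_sum_solutionsIn (w : ι → Fin 3 → F) (s : Fin 3 → F) (S : Finset ι) :
    (Set.ncard {x | Fintype.linearCombination F w x = s ∧ coordSupport x = S} : ℤ) =
      ∑ T ∈ S.powerset, (-1 : ℤ) ^ (S \ T).card * ((solutionsIn w s T).ncard : ℤ) := by
  have h1 : ∀ T, ((solutionsIn w s T).ncard : ℤ) =
      ∑ x : ι → F with Fintype.linearCombination F w x = s,
        if coordSupport x ⊆ T then 1 else 0 := by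
    intro T
    rw [Finset.sum_boole, Finset.filter_filter, ← Set.ncard_coe_finset, solutionsIn]
    simp
  simp only [h1, Finset.mul_sum]
  rw [Finset.sum_comm]
  simp only [sum_powerset_neg_one_pow_subset]
  rw [Finset.sum_boole, Finset.filter_filter, ← Set.ncard_coe_finset]
  simp

theorem syndromeWeightCount_eq_sum (w : ι → Fin 3 → F) (s : Fin 3 → F) (k : ℕ) :
    syndromeWeightCount w s k = ∑ S ∈ Finset.powersetCard k Finset.univ,
      Set.ncard {x | Fintype.linearCombination F w x = s ∧ coordSupport x = S} := by
  have h : {x | Fintype.linearCombination F w x = s ∧ hammingNorm x = k} =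
      ((Finset.univ.filter fun x => Fintype.linearCombination F w x = s ∧ hammingNorm x = k :
        Finset (ι → F)) : Set (ι → F)) := by
    simp
  rw [syndromeWeightCount, h, Set.ncard_coe_finset,
    Finset.card_eq_sum_card_fiberwise (f := coordSupport)
      (t := Finset.powersetCard k Finset.univ)]
  · refine Finset.sum_congr rfl fun S hS => ?_
    rw [← Set.ncard_coe_finset]
    congr 1
    ext x
    simp only [Finset.coe_filter, Finset.mem_filter, Finset.mem_univ, true_and,
      Set.mem_ofPred_eq]
    constructor
    · rintro ⟨⟨h, -⟩, h'⟩
      exact ⟨h, h'⟩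
    · rintro ⟨h, rfl⟩
      exact ⟨⟨h, (Finset.mem_powersetCard.1 hS).2⟩, rfl⟩
  · intro x hx
    simp only [Finset.coe_filter, Finset.mem_univ, true_and, Set.mem_ofPred_eq] at hx
    exact Finset.mem_coe.2 (Finset.mem_powersetCard.2 ⟨Finset.subset_univ _, hx.2⟩)

omit [DecidableEq F] [DecidableEq ι] [Fintype F] [Fintype ι] in
theorem offPoints_iff_forall_card_le_one (w : ι → Fin 3 → F) (s : Fin 3 → F) :
    OffPoints w s ↔ ∀ T : Finset ι, T.card ≤ 1 → s ∉ Submodule.span F (w '' T) := by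
  constructor
  · rintro ⟨h0, h1⟩ T hT
    rcases T.eq_empty_or_nonempty with rfl | hne
    · simpa using h0
    · obtain ⟨i, rfl⟩ := Finset.card_eq_one.1 (le_antisymm hT hne.card_pos)
      simpa using h1 i
  · intro h
    refine ⟨fun hs => h ∅ (by simp) (by simp [hs]), fun i hi => h {i} (by simp) (by simpa using hi)⟩

-- Double counting: each pair of indices lies in `(n - 2).choose (k - 2)` sets of size `k`, where
-- `n` is the number of indices.
omit [DecidableEq F] [Fintype F] in
open scoped Classical in
theorem sum_secantPairs_powersetCard {w : ι → Fin 3 → F} {s : Fin 3 → F} {k : ℕ} (hk : 2 ≤ k) :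
    ∑ S ∈ Finset.powersetCard k (Finset.univ : Finset ι),
      ∑ T ∈ Finset.powersetCard 2 S, (if s ∈ Submodule.span F (w '' T) then 1 else 0) =
    (Fintype.card ι - 2).choose (k - 2) * (secantPairs w s).ncard := by
  have h1 : ∀ S : Finset ι, ∑ T ∈ Finset.powersetCard 2 S,
      (if s ∈ Submodule.span F (w '' T) then 1 else 0) =
      ∑ T ∈ (secantPairs w s).toFinset, if T ⊆ S then 1 else 0 := by
    intro S
    rw [Finset.sum_boole, Finset.sum_boole]
    congr 2
    ext T
    rw [Finset.mem_filter, Finset.mem_filter, Finset.mem_powersetCard, Set.mem_toFinset]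
    simp only [secantPairs, Set.mem_ofPred_eq]
    tauto
  simp only [h1]
  rw [Finset.sum_comm, Set.ncard_eq_toFinset_card', mul_comm]
  apply Finset.sum_const_nat
  intro T hT
  have hT : T.card = 2 := (Set.mem_toFinset.1 hT).1
  have := Finset.card_filter_powersetCard_subset T Finset.univ k (Finset.subset_univ T) (by omega)
  rw [Finset.sum_boole]
  rw [hT, Finset.card_univ] at this
  exact_mod_cast this

/-- For a fixed support `S` of size `k`, only subsets of size at most 2 distinguish `s` from `0`.
Each contributes `-1` up to sign, since the zero syndrome has its trivial solution there, except
that a secant pair contributes `0`. Without secant pairs the total is `-(1 - k + k.choose 2) = -(k -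
1).choose 2`, up to the factor `(-1) ^ k`; the secant pairs give the correction term. -/
theorem IsArc.syndromeWeightCount_of_three_le {w : ι → Fin 3 → F} (hw : IsArc w)
    {s : Fin 3 → F} (hs : OffPoints w s) {k : ℕ} (hk : 3 ≤ k) :
    (syndromeWeightCount w s k : ℤ) = syndromeWeightCount w 0 k
      - (-1) ^ k * ((Fintype.card ι).choose k : ℤ) * ((k - 1).choose 2 : ℤ)
      + (-1) ^ k * ((Fintype.card ι - 2).choose (k - 2) : ℤ) * ((secantPairs w s).ncard : ℤ) := by
  classical
  have hoff := (offPoints_iff_forall_card_le_one w s).1 hs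
  have hS : ∀ S ∈ Finset.powersetCard k (Finset.univ : Finset ι),
      (Set.ncard {x | Fintype.linearCombination F w x = s ∧ coordSupport x = S} : ℤ) =
      Set.ncard {x | Fintype.linearCombination F w x = 0 ∧ coordSupport x = S}
        - (-1) ^ k * ((k - 1).choose 2 : ℤ) + (-1) ^ k *
        ∑ T ∈ Finset.powersetCard 2 S, (if s ∈ Submodule.span F (w '' T) then 1 else 0) := by
    intro S hS
    have hSk : S.card = k := (Finset.mem_powersetCard.1 hS).2
    suffices h : ∑ T ∈ S.powerset, (-1 : ℤ) ^ (S \ T).card *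
        ((solutionsIn w s T).ncard - (solutionsIn w 0 T).ncard : ℤ) =
        - (-1) ^ k * ((k - 1).choose 2 : ℤ) + (-1) ^ k *
        ∑ T ∈ Finset.powersetCard 2 S, (if s ∈ Submodule.span F (w '' T) then 1 else 0) by
      simp only [mul_sub, Finset.sum_sub_distrib] at h
      rw [ncard_eq_sum_solutionsIn, ncard_eq_sum_solutionsIn]
      linarith
    have hsub : Finset.range 3 ⊆ Finset.range (S.card + 1) := by
      intro i hi
      simp at hi ⊢
      omega
    have hneg : ∀ T ⊆ S, (-1 : ℤ) ^ (S \ T).card = (-1) ^ k * (-1) ^ T.card := by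
      intro T hT
      rw [Finset.card_sdiff_of_subset hT, hSk]
      have := Finset.card_le_card hT
      rw [hSk] at this
      obtain ⟨m, rfl⟩ := Nat.exists_eq_add_of_le this
      rw [Nat.add_sub_cancel_left, pow_add, mul_right_comm, ← mul_pow]
      simp
    have hlow : ∀ T : Finset ι, T.card ≤ 3 → ((solutionsIn w s T).ncard -
        (solutionsIn w 0 T).ncard : ℤ) =
        (if s ∈ Submodule.span F (w '' T) then 1 else 0) - 1 := by
      intro T hT
      rw [hw.ncard_solutionsIn s hT, hw.ncard_solutionsIn 0 hT]
      simp
    rw [Finset.sum_powerset, ← Finset.sum_subset hsub]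
    · simp only [Finset.sum_range_succ, Finset.sum_range_zero, zero_add]
      have hj : ∀ j ≤ 1, ∑ T ∈ Finset.powersetCard j S, (-1 : ℤ) ^ (S \ T).card *
          ((solutionsIn w s T).ncard - (solutionsIn w 0 T).ncard : ℤ) =
          (k.choose j : ℤ) * ((-1) ^ k * (-1) ^ j * (-1)) := by
        intro j hj
        rw [← hSk, ← Finset.card_powersetCard j S, ← nsmul_eq_mul]
        apply Finset.sum_eq_card_nsmul
        intro T hT
        obtain ⟨hTS, hTj⟩ := Finset.mem_powersetCard.1 hT
        rw [hneg T hTS, hlow T (by omega), if_neg (hoff T (by omega)), hTj, hSk]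
        ring
      have h2 : ∑ T ∈ Finset.powersetCard 2 S, (-1 : ℤ) ^ (S \ T).card *
          ((solutionsIn w s T).ncard - (solutionsIn w 0 T).ncard : ℤ) =
          (-1) ^ k * (∑ T ∈ Finset.powersetCard 2 S,
            (if s ∈ Submodule.span F (w '' T) then 1 else 0) - (k.choose 2 : ℤ)) := by
        have : (k.choose 2 : ℤ) = ∑ T ∈ Finset.powersetCard 2 S, 1 := by
          simp [hSk]
        rw [this, ← Finset.sum_sub_distrib, Finset.mul_sum]
        refine Finset.sum_congr rfl fun T hT => ?_
        obtain ⟨hTS, hTj⟩ := Finset.mem_powersetCard.1 hT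
        rw [hneg T hTS, hlow T (by omega), hTj]
        ring
      rw [hj 0 (by omega), hj 1 le_rfl, h2]
      -- Pascal's rule with `k = m + 1` turns `1 - k + k.choose 2` into `m.choose 2`.
      obtain ⟨m, rfl⟩ := Nat.exists_eq_add_of_le' (show 1 ≤ k by omega)
      simp only [Nat.choose_zero_right, Nat.choose_one_right, Nat.add_sub_cancel,
        Nat.choose_succ_succ' m 1]
      push_cast
      ring
    · intro j hj hj3
      refine Finset.sum_eq_zero fun T hT => ?_
      obtain ⟨-, hTj⟩ := Finset.mem_powersetCard.1 hT
      rw [hw.ncard_solutionsIn_of_three_le s (by simp at hj3; omega), sub_self, mul_zero]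
  have hsum : ∑ S ∈ Finset.powersetCard k (Finset.univ : Finset ι),
      ∑ T ∈ Finset.powersetCard 2 S, (if s ∈ Submodule.span F (w '' T) then (1 : ℤ) else 0) =
      ((Fintype.card ι - 2).choose (k - 2) : ℤ) * (secantPairs w s).ncard := by
    exact_mod_cast sum_secantPairs_powersetCard (w := w) (s := s) (k := k) (by omega)
  rw [syndromeWeightCount_eq_sum, syndromeWeightCount_eq_sum]
  push_cast
  rw [Finset.sum_congr rfl hS, Finset.sum_add_distrib, Finset.sum_sub_distrib, 
    Finset.sum_const, ← Finset.mul_sum, hsum, Finset.card_powersetCard, Finset.card_univ, nsmul_eq_mul]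
  ring

omit [Fintype F] in
theorem exists_hammingNorm_le_iff (w : ι → Fin 3 → F) (s : Fin 3 → F) {k : ℕ} :
    (∃ x, Fintype.linearCombination F w x = s ∧ hammingNorm x ≤ k) ↔
      ∃ T : Finset ι, T.card ≤ k ∧ s ∈ Submodule.span F (w '' T) := by
  constructor
  · rintro ⟨x, hx, hk⟩
    exact ⟨coordSupport x, hk, (solutionsIn_nonempty_iff w s _).1 ⟨x, hx, subset_rfl⟩⟩
  · rintro ⟨T, hT, hs⟩
    obtain ⟨x, hx, hxT⟩ := (solutionsIn_nonempty_iff w s T).2 hs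
    exact ⟨x, hx, (Finset.card_le_card hxT).trans hT⟩

theorem OffPoints.syndromeWeightCount_le_one {w : ι → Fin 3 → F} {s : Fin 3 → F}
    (hs : OffPoints w s) {k : ℕ} (hk : k ≤ 1) : syndromeWeightCount w s k = 0 := by
  rw [syndromeWeightCount, Set.ncard_eq_zero, Set.eq_empty_iff_forall_notMem]
  rintro x ⟨hx, hxk⟩
  obtain ⟨T, hT, hs'⟩ := (exists_hammingNorm_le_iff w s).1 ⟨x, hx, (hxk.trans_le hk)⟩
  exact (offPoints_iff_forall_card_le_one w s).1 hs T hT hs'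

-- A secant pair supports exactly one solution, and neither coordinate of it vanishes because `s` is
-- off the points. So taking supports is a bijection.
omit [Fintype F] in
theorem IsArc.syndromeWeightCount_two {w : ι → Fin 3 → F} (hw : IsArc w) {s : Fin 3 → F}
    (hs : OffPoints w s) : syndromeWeightCount w s 2 = (secantPairs w s).ncard := by
  have hoff := (offPoints_iff_forall_card_le_one w s).1 hs
  refine Set.ncard_congr (fun x _ => coordSupport x) ?_ ?_ ?_
  · rintro x ⟨hx, h2⟩
    exact ⟨h2, (solutionsIn_nonempty_iff w s _).1 ⟨x, hx, subset_rfl⟩⟩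
  · rintro x y ⟨hx, hx2⟩ ⟨hy, hy2⟩ h
    refine hw.solutionsIn_subsingleton s (T := coordSupport x) ?_ ⟨hx, subset_rfl⟩ ⟨hy, h.ge⟩
    rw [card_coordSupport, hx2]
    omega
  · rintro T ⟨hT, hsT⟩
    obtain ⟨x, hx, hxT⟩ := (solutionsIn_nonempty_iff w s T).2 hsT
    have h2 : 2 ≤ (coordSupport x).card := by
      by_contra h
      exact hoff (coordSupport x) (by omega)
        ((solutionsIn_nonempty_iff w s _).1 ⟨x, hx, subset_rfl⟩)
    have heq := Finset.eq_of_subset_of_card_le hxT (by omega)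
    exact ⟨x, ⟨hx, by rw [← card_coordSupport, heq, hT]⟩, heq⟩

omit [Fintype F] [DecidableEq ι] in
theorem IsArc.four_le_hammingNorm {w : ι → Fin 3 → F} (hw : IsArc w) {x : ι → F} (hx0 : x ≠ 0)
    (hx : Fintype.linearCombination F w x = 0) : 4 ≤ hammingNorm x := by
  by_contra h
  rw [← card_coordSupport] at h
  refine hx0 (hw.solutionsIn_subsingleton 0 (T := coordSupport x) (by omega) ⟨hx, subset_rfl⟩
    ⟨map_zero _, ?_⟩)
  simp [coordSupport]

end Syndromes

/-! ### Cosets as syndromes: coset weights, minimum distance, covering radius -/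

section Cosets

variable {F : Type*} [Field F] [DecidableEq F] {n : ℕ} {w : Fin n → Fin 3 → F}

omit [DecidableEq F] in
theorem IsArc.linearCombination_surjective (hw : IsArc w) (hn : 3 ≤ n) :
    Function.Surjective (Fintype.linearCombination F w) := by
  classical
  intro s
  obtain ⟨x, hx, -⟩ := (solutionsIn_nonempty_iff w s Finset.univ).2
    (hw.mem_span s (by simpa using hn))
  exact ⟨x, hx⟩

/-- The cosets of a code correspond to the syndromes. -/
noncomputable def syndromeEquiv (hw : IsArc w) (hn : 3 ≤ n) :
    ((Fin n → F) ⧸ LinearMap.ker (Fintype.linearCombination F w)) ≃ (Fin 3 → F) :=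
  (LinearMap.quotKerEquivOfSurjective _ (hw.linearCombination_surjective hn)).toEquiv

omit [DecidableEq F] in
theorem mk_eq_iff_syndrome (hw : IsArc w) (hn : 3 ≤ n) (x : Fin n → F)
    (V : (Fin n → F) ⧸ LinearMap.ker (Fintype.linearCombination F w)) :
    Submodule.Quotient.mk x = V ↔ Fintype.linearCombination F w x = syndromeEquiv hw hn V := by
  rw [← (syndromeEquiv hw hn).injective.eq_iff]
  rfl

theorem cosetWeightCount_eq (hw : IsArc w) (hn : 3 ≤ n)
    (V : (Fin n → F) ⧸ LinearMap.ker (Fintype.linearCombination F w)) (k : ℕ) :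
    cosetWeightCount V k = syndromeWeightCount w (syndromeEquiv hw hn V) k := by
  simp only [cosetWeightCount, syndromeWeightCount, mk_eq_iff_syndrome hw hn]

theorem cosetWeight_le_iff (hw : IsArc w) (hn : 3 ≤ n)
    (V : (Fin n → F) ⧸ LinearMap.ker (Fintype.linearCombination F w)) (k : ℕ) :
    cosetWeight V ≤ k ↔
      ∃ T : Finset (Fin n), T.card ≤ k ∧ syndromeEquiv hw hn V ∈ Submodule.span F (w '' T) := by
  rw [← exists_hammingNorm_le_iff]
  simp only [← mk_eq_iff_syndrome hw hn]
  constructor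
  · intro h
    -- The coset is nonempty, so `sInf` is an attained minimum and not the default value `0`.
    obtain ⟨x, hx⟩ := Submodule.Quotient.mk_surjective _ V
    obtain ⟨y, hy, hy'⟩ := Nat.sInf_mem
      (s := {k | ∃ x : Fin n → F, Submodule.Quotient.mk x = V ∧ hammingNorm x = k}) ⟨_, x, hx, rfl⟩
    exact ⟨y, hy, hy'.trans_le h⟩
  · rintro ⟨x, hx, hk⟩
    exact le_trans (Nat.sInf_le ⟨x, hx, rfl⟩) hk

theorem cosetWeight_le_three (hw : IsArc w) (hn : 3 ≤ n)
    (V : (Fin n → F) ⧸ LinearMap.ker (Fintype.linearCombination F w)) : cosetWeight V ≤ 3 := by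
  obtain ⟨T, -, hT⟩ := Finset.exists_subset_card_eq
    (show 3 ≤ (Finset.univ : Finset (Fin n)).card by simpa using hn)
  exact (cosetWeight_le_iff hw hn V 3).2 ⟨T, hT.le, hw.mem_span _ hT.ge⟩

theorem two_le_cosetWeight_iff (hw : IsArc w) (hn : 3 ≤ n)
    (V : (Fin n → F) ⧸ LinearMap.ker (Fintype.linearCombination F w)) :
    2 ≤ cosetWeight V ↔ OffPoints w (syndromeEquiv hw hn V) := by
  rw [offPoints_iff_forall_card_le_one, ← not_lt, Nat.lt_succ_iff, cosetWeight_le_iff hw hn]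
  push Not
  rfl

theorem three_le_cosetWeight_iff (hw : IsArc w) (hn : 3 ≤ n)
    (V : (Fin n → F) ⧸ LinearMap.ker (Fintype.linearCombination F w)) :
    3 ≤ cosetWeight V ↔ OffPoints w (syndromeEquiv hw hn V) ∧
      (secantPairs w (syndromeEquiv hw hn V)).ncard = 0 := by
  rw [Set.ncard_eq_zero, Set.eq_empty_iff_forall_notMem, offPoints_iff_forall_card_le_one, ← not_lt,
    Nat.lt_succ_iff, cosetWeight_le_iff hw hn]
  push Not
  constructor
  · exact fun h => ⟨fun T hT => h T (by omega), fun T hT => h T hT.1.le hT.2⟩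
  · rintro ⟨h1, h2⟩ T hT hs
    rcases Nat.lt_or_ge T.card 2 with h | h
    · exact h1 T (by omega) hs
    · exact h2 T ⟨by omega, hs⟩

theorem cosetWeight_eq_two_iff (hw : IsArc w) (hn : 3 ≤ n)
    (V : (Fin n → F) ⧸ LinearMap.ker (Fintype.linearCombination F w)) :
    cosetWeight V = 2 ↔ OffPoints w (syndromeEquiv hw hn V) ∧
      (secantPairs w (syndromeEquiv hw hn V)).ncard ≠ 0 := by
  have h2 := two_le_cosetWeight_iff hw hn V
  have h3 := three_le_cosetWeight_iff hw hn V
  constructor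
  · intro h
    have := h2.1 h.ge
    exact ⟨this, fun h0 => absurd (h3.2 ⟨this, h0⟩) (by omega)⟩
  · rintro ⟨hoff, h0⟩
    have : ¬ 3 ≤ cosetWeight V := fun h => h0 (h3.1 h).2
    have := h2.2 hoff
    omega

theorem cosetWeight_eq_three_iff (hw : IsArc w) (hn : 3 ≤ n)
    (V : (Fin n → F) ⧸ LinearMap.ker (Fintype.linearCombination F w)) :
    cosetWeight V = 3 ↔ OffPoints w (syndromeEquiv hw hn V) ∧
      (secantPairs w (syndromeEquiv hw hn V)).ncard = 0 := by
  rw [← three_le_cosetWeight_iff]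
  exact ⟨fun h => h.ge, fun h => (cosetWeight_le_three hw hn V).antisymm h⟩

omit [DecidableEq F] in
theorem ncard_cosets (hw : IsArc w) (hn : 3 ≤ n) (p : (Fin 3 → F) → Prop) :
    Set.ncard {V | p (syndromeEquiv hw hn V)} = Set.ncard {s | p s} := by
  rw [← Set.ncard_image_of_injective _ (syndromeEquiv hw hn).injective]
  congr 1
  ext s
  obtain ⟨V, rfl⟩ := (syndromeEquiv hw hn).surjective s
  simp

/-- Four vectors in `F³` are dependent, which gives a nonzero codeword of weight at most 4;
independence of any three columns excludes smaller weights. -/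
theorem codeMinDist_eq_four (hw : IsArc w) (hn : 4 ≤ n) :
    codeMinDist (LinearMap.ker (Fintype.linearCombination F w)) = 4 := by
  obtain ⟨T, -, hT⟩ := Finset.exists_subset_card_eq
    (show 4 ≤ (Finset.univ : Finset (Fin n)).card by simpa using hn)
  have hdep : ¬ LinearIndepOn F w (T : Set (Fin n)) := by
    intro h
    have := h.fintype_card_le_finrank
    simp [hT] at this
  have hdep' : ∃ x : Fin n → F, x ≠ 0 ∧ Fintype.linearCombination F w x = 0 ∧
      hammingNorm x ≤ 4 := by
    rw [linearIndepOn_finset_iff] at hdep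
    push Not at hdep
    obtain ⟨g, hg, i, hi, hgi⟩ := hdep
    have hsub : coordSupport (fun i => if i ∈ T then g i else 0) ⊆ T := by
      intro i hi
      by_contra h
      simp [coordSupport, h] at hi
    refine ⟨fun i => if i ∈ T then g i else 0, fun h => hgi ?_, ?_, ?_⟩
    · simpa [hi] using congrFun h i
    · rw [linearCombination_eq_sum_of_subset w hsub, ← hg]
      exact Finset.sum_congr rfl fun i hi => by simp [hi]
    · exact hT ▸ Finset.card_le_card hsub
  obtain ⟨x, hx0, hx, hx4⟩ := hdep'
  apply le_antisymm
  · exact le_trans (Nat.sInf_le ⟨x, hx, hx0, rfl⟩) hx4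
  · refine le_csInf ⟨_, x, hx, hx0, rfl⟩ ?_
    rintro _ ⟨c, hc, hc0, rfl⟩
    exact hw.four_le_hammingNorm hc0 hc

/-- The distance from `x` to the code is the weight of the coset of `x`, so the covering radius is
the largest coset weight. The given coset shows that the bound 3 is attained. -/
theorem coveringRadius_eq_three (hw : IsArc w) (hn : 3 ≤ n)
    (V : (Fin n → F) ⧸ LinearMap.ker (Fintype.linearCombination F w)) (hV : cosetWeight V = 3) :
    coveringRadius (LinearMap.ker (Fintype.linearCombination F w)) = 3 := by
  have key : ∀ (x : Fin n → F) (R : ℕ),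
      (∃ c ∈ LinearMap.ker (Fintype.linearCombination F w), hammingDist x c ≤ R) ↔
      cosetWeight (Submodule.Quotient.mk x :
        (Fin n → F) ⧸ LinearMap.ker (Fintype.linearCombination F w)) ≤ R := by
    intro x R
    rw [cosetWeight_le_iff hw hn, ← exists_hammingNorm_le_iff,
      ← (mk_eq_iff_syndrome hw hn x _).1 rfl]
    constructor
    · rintro ⟨c, hc, hR⟩
      refine ⟨x - c, by simpa using hc, ?_⟩
      rwa [hammingDist_comm, hammingDist_eq_hammingNorm, neg_add_eq_sub] at hR
    · rintro ⟨y, hy, hR⟩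
      refine ⟨x - y, by simp [hy], ?_⟩
      rw [hammingDist_comm, hammingDist_eq_hammingNorm]
      simpa using hR
  apply le_antisymm
  · exact Nat.sInf_le fun x => (key x 3).2 (cosetWeight_le_three hw hn _)
  · refine le_csInf ⟨3, fun x => (key x 3).2 (cosetWeight_le_three hw hn _)⟩ fun R hR => ?_
    obtain ⟨x, rfl⟩ := Submodule.Quotient.mk_surjective _ V
    exact hV ▸ (key x R).1 (hR x)

end Cosets

/-! ### The columns of the shortened matrix as a shortened conic -/

section ShortenedMatrix

variable {F : Type*} [Field F] {q : ℕ}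

/-- The conic parameter of the point represented by a column of `gdrsMatrix`. -/
def columnParam {F : Type*} (α : Fin q ≃ F) : Fin (q + 1) → Option F :=
  Fin.lastCases none fun k => some (α k)

theorem columnParam_bijective {F : Type*} (α : Fin q ≃ F) : Function.Bijective (columnParam α) := by
  constructor
  · intro i j
    induction i using Fin.lastCases <;> induction j using Fin.lastCases <;>
      simp [columnParam]
  · intro r
    cases r with
    | none => exact ⟨Fin.last q, by simp [columnParam]⟩
    | some t => exact ⟨(α.symm t).castSucc, by simp [columnParam]⟩

theorem gdrsMatrix_col (α : Fin q ≃ F) (v : Fin (q + 1) → Fˣ) (i : Fin (q + 1)) :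
    (gdrsMatrix α v).col i = (v i : F) • conicVector (columnParam α i) := by
  funext r
  induction i using Fin.lastCases <;> simp [gdrsMatrix, columnParam, Matrix.col]

theorem shortenedMatrix_col (α : Fin q ≃ F) (v : Fin (q + 1) → Fˣ) (j : Fin (q + 1))
    (i : Fin q) : (shortenedMatrix α v j).col i =
      (v (j.succAbove i) : F) • conicVector (columnParam α (j.succAbove i)) :=
  gdrsMatrix_col α v _

theorem isConicFrame_shortenedMatrix [Fintype F] (hcard : Fintype.card F = q) (α : Fin q ≃ F)
    (v : Fin (q + 1) → Fˣ) (j : Fin (q + 1)) : IsConicFrame (shortenedMatrix α v j).col :=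
  isConicFrame_of_conicVector (by simp [hcard]) (LinearEquiv.refl F _) (columnParam α j)
    (ρ := fun i => columnParam α (j.succAbove i))
    ((columnParam_bijective α).1.comp Fin.succAbove_right_injective)
    (fun i h => Fin.succAbove_ne j i ((columnParam_bijective α).1 h))
    (fun i => v (j.succAbove i)) (shortenedMatrix_col α v j)

theorem codeOfParityCheck_eq_ker {n : ℕ} (H : Matrix (Fin 3) (Fin n) F) :
    codeOfParityCheck H = LinearMap.ker (Fintype.linearCombination F H.col) := by
  unfold codeOfParityCheck
  congr 1
  refine LinearMap.ext fun x => ?_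
  funext r
  rw [Fintype.linearCombination_apply, Finset.sum_apply]
  change ∑ i, H r i * x i = ∑ i, x i * H r i
  exact Finset.sum_congr rfl fun i _ => mul_comm _ _

/-- The columns of the shortened matrix are the points of the conic other than the point of the
removed column. -/
theorem range_mk_shortenedMatrix_col (α : Fin q ≃ F) (v : Fin (q + 1) → Fˣ) (j : Fin (q + 1))
    (hcol : ∀ i, (shortenedMatrix α v j).col i ≠ 0) :
    Set.range (fun i => Projectivization.mk F ((shortenedMatrix α v j).col i) (hcol i)) =
      standardConic F \
        {Projectivization.mk F (conicVector (columnParam α j)) (conicVector_ne_zero _)} := by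
  have hmk : ∀ i, Projectivization.mk F ((shortenedMatrix α v j).col i) (hcol i) =
      Projectivization.mk F (conicVector (columnParam α (j.succAbove i)))
        (conicVector_ne_zero _) := by
    intro i
    rw [Projectivization.mk_eq_mk_iff]
    exact ⟨v (j.succAbove i), (shortenedMatrix_col α v j i).symm⟩
  ext Q
  simp only [hmk]
  constructor
  · rintro ⟨i, rfl⟩
    refine ⟨⟨_, rfl⟩, fun h => ?_⟩
    obtain ⟨a, ha⟩ := (Projectivization.mk_eq_mk_iff' F _ _ _ _).1 h
    exact Fin.succAbove_ne j i ((columnParam_bijective α).1 (eq_of_conicVector_eq_smul ha.symm))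
  · rintro ⟨⟨r, rfl⟩, h⟩
    obtain ⟨i, rfl⟩ := (columnParam_bijective α).2 r
    have hij : i ≠ j := by
      rintro rfl
      exact h rfl
    obtain ⟨k, rfl⟩ := Fin.exists_succAbove_eq hij
    exact ⟨k, rfl⟩

end ShortenedMatrix

/-! ### Assembly of the geometric and coding statements -/

theorem mainTheorem11 {F : Type*} [Field F] [Fintype F] [DecidableEq F] (q : ℕ)
    (hcard : Fintype.card F = q) (hq : 5 ≤ q) :
    -- the classes of points off a shortened conic
    (∀ (K : Set (ℙ F (Fin 3 → F))) (P : ℙ F (Fin 3 → F)), IsConic K → P ∈ K →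
      Set.ncard (K \ {P})ᶜ = q ^ 2 + 1 ∧
      ∃ A : Fin 3 → Set (ℙ F (Fin 3 → F)),
        Pairwise (fun i j => Disjoint (A i) (A j)) ∧
        (⋃ j, A j) = (K \ {P})ᶜ ∧
        ∀ j, Set.ncard (A j) = classSize q j ∧
          ∀ Q ∈ A j, bisecantCount (K \ {P}) Q = classBisecants q j) ∧
    -- the code
    (∀ (α : Fin q ≃ F) (v : Fin (q + 1) → Fˣ) (j : Fin (q + 1))
        (C : Submodule F (Fin q → F)), C = codeOfParityCheck (shortenedMatrix α v j) →
      -- `C` is a `[q, q-3, 4]` code of covering radius `3`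
      Module.finrank F C = q - 3 ∧ codeMinDist C = 4 ∧ coveringRadius C = 3 ∧
      -- the columns of its parity check matrix are the points of the shortened conic
      (∃ (P : ℙ F (Fin 3 → F)) (hcol : ∀ i, (shortenedMatrix α v j).col i ≠ 0),
        P ∈ standardConic F ∧ P.submodule = Submodule.span F {(gdrsMatrix α v).col j} ∧
        Function.Injective
          (fun i => Projectivization.mk F ((shortenedMatrix α v j).col i) (hcol i)) ∧
        Set.range (fun i => Projectivization.mk F ((shortenedMatrix α v j).col i) (hcol i)) =
          standardConic F \ {P}) ∧
      -- the two classes of weight 2 cosets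
      Set.ncard {V : (Fin q → F) ⧸ C | cosetWeight V = 2 ∧
        cosetWeightCount V 2 = classBisecants q 0} = (q - 1) * classSize q 0 ∧
      Set.ncard {V : (Fin q → F) ⧸ C | cosetWeight V = 2 ∧
        cosetWeightCount V 2 = classBisecants q 1} = (q - 1) * classSize q 1 ∧
      (∀ V : (Fin q → F) ⧸ C, cosetWeight V = 2 →
        (cosetWeightCount V 2 = classBisecants q 0 ∨
          cosetWeightCount V 2 = classBisecants q 1) ∧
        (∀ w < 2, cosetWeightCount V w = 0) ∧
        ∀ w, 3 ≤ w → w ≤ q →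
          (cosetWeightCount V w : ℤ) = codeWeightCount C w
            - (-1) ^ w * (q.choose w : ℤ) * ((w - 1).choose 2 : ℤ)
            + (-1) ^ w * ((q - 2).choose (q - w) : ℤ) * (cosetWeightCount V 2 : ℤ)) ∧
      -- the weight 3 cosets
      Set.ncard {V : (Fin q → F) ⧸ C | cosetWeight V = 3} = (q - 1) * classSize q 2 ∧
      ∀ V : (Fin q → F) ⧸ C, cosetWeight V = 3 →
        (∀ w ≤ 2, cosetWeightCount V w = 0) ∧
        cosetWeightCount V 3 = q.choose 3 ∧
        ∀ w, 4 ≤ w → w ≤ q + 1 →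
          (cosetWeightCount V w : ℤ) = codeWeightCount C w
            - (-1) ^ w * (q.choose w : ℤ) * ((w - 1).choose 2 : ℤ)) := by
  -- A syndrome off the points has coset weight 2 or 3 according to whether it has a secant pair, so
  -- the first two classes give weight 2 and the last gives weight 3.
  have hcount : ∀ k : Fin 3, k ≠ 2 → classBisecants q k ≠ 0 := by
    intro k hk h
    refine hk (classBisecants_injective hq (h.trans ?_))
    unfold classBisecants
    split_ifs <;> rfl
  have hcount2 : classBisecants q 2 = 0 := by
    unfold classBisecants
    split_ifs <;> rfl
  refine ⟨fun K P hK hP => ?_, ?_⟩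
  · obtain ⟨w, hw, harc, hS⟩ := hK.exists_frame (by omega) hP
    exact hw.point_classes hcard hq hcard harc hS
  · intro α v j C hC
    have hframe := isConicFrame_shortenedMatrix hcard α v j
    have harc := hframe.isArc (by simp; omega)
    have hn : 3 ≤ q := by omega
    obtain ⟨hex, hsize⟩ := hframe.classes hcard hq
    rw [codeOfParityCheck_eq_ker] at hC
    subst hC
    have hsize2 : ∀ k : Fin 3, k ≠ 2 →
        Set.ncard {V : (Fin q → F) ⧸ LinearMap.ker (Fintype.linearCombination F
          (shortenedMatrix α v j).col) | cosetWeight V = 2 ∧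
          cosetWeightCount V 2 = classBisecants q k} = (q - 1) * classSize q k := by
      intro k hk
      rw [← hsize k, ← ncard_cosets harc hn]
      congr 1
      ext V
      simp only [Set.mem_ofPred_eq, cosetWeight_eq_two_iff harc hn, cosetWeightCount_eq harc hn]
      constructor
      · rintro ⟨⟨h1, h2⟩, h3⟩
        exact ⟨h1, (harc.syndromeWeightCount_two h1).symm.trans h3⟩
      · rintro ⟨h1, h2⟩
        exact ⟨⟨h1, h2 ▸ hcount k hk⟩, (harc.syndromeWeightCount_two h1).trans h2⟩
    have hsize3 : Set.ncard {V : (Fin q → F) ⧸ LinearMap.ker (Fintype.linearCombination F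
          (shortenedMatrix α v j).col) | cosetWeight V = 3} = (q - 1) * classSize q 2 := by
      rw [← hsize 2, ← ncard_cosets harc hn, hcount2]
      simp only [cosetWeight_eq_three_iff harc hn]
    refine ⟨?_, codeMinDist_eq_four harc (by omega), ?_, ?_, hsize2 0 (by decide),
      hsize2 1 (by decide), ?_, hsize3, ?_⟩
    · have h1 := (Fintype.linearCombination F
        (shortenedMatrix α v j).col).finrank_range_add_finrank_ker
      rw [LinearMap.range_eq_top.2 (harc.linearCombination_surjective hn)] at h1
      simp at h1
      omega
    · have hne : Set.ncard {V : (Fin q → F) ⧸ LinearMap.ker (Fintype.linearCombination F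
          (shortenedMatrix α v j).col) | cosetWeight V = 3} ≠ 0 := by
        rw [hsize3]
        refine Nat.mul_ne_zero (by omega) ?_
        unfold classSize
        split_ifs <;> simp
      obtain ⟨V, hV⟩ := Set.nonempty_of_ncard_ne_zero hne
      exact coveringRadius_eq_three harc hn V hV
    · refine ⟨Projectivization.mk F (conicVector (columnParam α j)) (conicVector_ne_zero _),
        harc.ne_zero, ⟨_, rfl⟩, ?_, harc.mk_injective, range_mk_shortenedMatrix_col α v j _⟩
      rw [Projectivization.submodule_mk, gdrsMatrix_col]
      exact (Submodule.span_singleton_smul_eq (v j).isUnit _).symm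
    · intro V hV
      obtain ⟨hoff, h0⟩ := (cosetWeight_eq_two_iff harc hn V).1 hV
      simp only [cosetWeightCount_eq harc hn]
      refine ⟨?_, fun k hk => hoff.syndromeWeightCount_le_one (by omega), fun k h3 hk => ?_⟩
      · rw [harc.syndromeWeightCount_two hoff]
        obtain ⟨k, hk⟩ := hex _ hoff
        fin_cases k
        · exact Or.inl hk
        · exact Or.inr hk
        · exact absurd (hk.trans hcount2) h0
      · rw [harc.syndromeWeightCount_two hoff, harc.syndromeWeightCount_of_three_le hoff h3,
          Fintype.card_fin, ← Nat.choose_symm (n := q - 2) (k := k - 2) (by omega),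
          show q - 2 - (k - 2) = q - k by omega]
        rfl
    · intro V hV
      obtain ⟨hoff, h0⟩ := (cosetWeight_eq_three_iff harc hn V).1 hV
      have hform : ∀ k, 3 ≤ k → (cosetWeightCount V k : ℤ) =
          codeWeightCount (LinearMap.ker (Fintype.linearCombination F
            (shortenedMatrix α v j).col)) k
            - (-1) ^ k * (q.choose k : ℤ) * ((k - 1).choose 2 : ℤ) := by
        intro k hk
        rw [cosetWeightCount_eq harc hn, harc.syndromeWeightCount_of_three_le hoff hk, h0,
          Fintype.card_fin, Nat.cast_zero, mul_zero, add_zero]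
        rfl
      refine ⟨fun k hk => ?_, ?_, fun k hk _ => hform k (by omega)⟩
      · rw [cosetWeightCount_eq harc hn]
        rcases Nat.lt_or_ge k 2 with h | h
        · exact hoff.syndromeWeightCount_le_one (by omega)
        · obtain rfl : k = 2 := by omega
          rw [harc.syndromeWeightCount_two hoff, h0]
      -- There are no codewords of weight 3, so the general formula at weight 3 reduces to `-(-1) ^
      -- 3 * q.choose 3 * (2).choose 2`.
      · have hz : codeWeightCount (LinearMap.ker (Fintype.linearCombination F
            (shortenedMatrix α v j).col)) 3 = 0 := by
          rw [codeWeightCount, Set.ncard_eq_zero, Set.eq_empty_iff_forall_notMem]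
          rintro c ⟨hc, hc3⟩
          have := harc.four_le_hammingNorm (x := c) (by rintro rfl; simp at hc3) hc
          omega
        have := hform 3 le_rfl
        rw [hz] at this
        simp at this
        exact_mod_cast this
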